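/- **Theorem (Symmetric Grothendieck inequalities).** Let $\Bbbk = \mathbb{R}$ or $\mathbb{C}$, let $\mathbb{S}^n(\Bbbk)$ be the set of symmetric (if $\Bbbk=\mathbb{R}$) or Hermitian (if $\Bbbk=\mathbb{C}$) $n \times n$ matrices over $\Bbbk$, and let $\langle x,y\rangle = x^*y$ be the standard inner product on $\Bbbk^d$. For $A=(a_{ij}) \in \mathbb{S}^n(\Bbbk)$ and $d \ge n$, put $$\|A\|_\gamma = \max_{\|x_i\|=1}\Bigl|\sum_{i,j=1}^n a_{ij}\langle x_i,x_j\rangle\Bigr|,\qquad \|A\|_\Gamma = \max_{\|x_i\|\le 1}\Bigl|\sum_{i,j=1}^n a_{ij}\langle x_i,x_j\rangle\Bigr|,$$ where the maxima are over $x_1,\dots,x_n\in\Bbbk^d$, and $$\|A\|_\theta = \max_{|\delta_i|=1}\Bigl|\sum_{i,j=1}^n a_{ij}\bar\delta_i\delta_j\Bigr|,\qquad \|A\|_\Theta = \max_{|\delta_i|\le 1}\Bigl|\sum_{i,j=1}^n a_{ij}\bar\delta_i\delta_j\Bigr|,$$ where the maxima are over $\delta_1,\dots,\delta_n\in\Bbbk$.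 Then there are constants $K_\gamma^\Bbbk, K_\Gamma^\Bbbk>0$, depending only on $\Bbbk$ (not on $n$, $d$ or $A$), such that $$\|A\|_\gamma \le K_\gamma^\Bbbk\,\|A\|_\theta \qquad\text{and}\qquad \|A\|_\Gamma \le K_\Gamma^\Bbbk\,\|A\|_\Theta$$ for all $n$, all $d\ge n$ and all $A\in\mathbb{S}^n(\Bbbk)$. Furthermore, the smallest such constants $K_\gamma^\Bbbk$ and $K_\Gamma^\Bbbk$ exist and satisfy $$K_\Gamma^{\mathbb{R}} \le K_\gamma^{\mathbb{R}} \le \sinh\frac{\pi}{2},\qquad K_\Gamma^{\mathbb{C}} \le K_\gamma^{\mathbb{C}} \le \frac{8}{\pi}-1 .$$ -/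

import Mathlib

/-!
Throughout, `𝕜` is `ℝ` or `ℂ` (an `RCLike` field), `A` is an `n × n` matrix over `𝕜`, and `𝕜ᵈ` is
`EuclideanSpace 𝕜 (Fin d)` with its standard inner product `⟪x, y⟫ = x* y`, conjugate-linear in the
first argument.
-/

noncomputable section

namespace SymmetricGrothendieck

variable {𝕜 : Type*} [RCLike 𝕜]

/-- `|∑ i, ∑ j, a_ij ⟪x_i, x_j⟫|` for vectors `x_1, …, x_n` in `𝕜ᵈ`. -/
def vectorForm {n : ℕ} (d : ℕ) (A : Matrix (Fin n) (Fin n) 𝕜)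
    (x : Fin n → EuclideanSpace 𝕜 (Fin d)) : ℝ :=
  ‖∑ i, ∑ j, A i j * inner 𝕜 (x i) (x j)‖

/-- `|∑ i, ∑ j, a_ij conj(δ_i) δ_j|` for scalars `δ_1, …, δ_n` in `𝕜`. -/
def scalarForm {n : ℕ} (A : Matrix (Fin n) (Fin n) 𝕜) (δ : Fin n → 𝕜) : ℝ :=
  ‖∑ i, ∑ j, A i j * starRingEnd 𝕜 (δ i) * δ j‖

/-- `‖A‖_γ` computed in `𝕜ᵈ`: the maximum of `|∑ a_ij ⟪x_i, x_j⟫|` over unit vectors. -/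
def gammaSeminorm {n : ℕ} (d : ℕ) (A : Matrix (Fin n) (Fin n) 𝕜) : ℝ :=
  sSup (vectorForm d A '' {x | ∀ i, ‖x i‖ = 1})

/-- `‖A‖_Γ` computed in `𝕜ᵈ`: the maximum of `|∑ a_ij ⟪x_i, x_j⟫|` over the closed unit ball. -/
def GammaNorm {n : ℕ} (d : ℕ) (A : Matrix (Fin n) (Fin n) 𝕜) : ℝ :=
  sSup (vectorForm d A '' {x | ∀ i, ‖x i‖ ≤ 1})

/-- `‖A‖_θ`: the maximum of `|∑ a_ij conj(δ_i) δ_j|` over unimodular scalars. -/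
def thetaSeminorm {n : ℕ} (A : Matrix (Fin n) (Fin n) 𝕜) : ℝ :=
  sSup (scalarForm A '' {δ | ∀ i, ‖δ i‖ = 1})

/-- `‖A‖_Θ`: the maximum of `|∑ a_ij conj(δ_i) δ_j|` over the closed unit disk. -/
def ThetaNorm {n : ℕ} (A : Matrix (Fin n) (Fin n) 𝕜) : ℝ :=
  sSup (scalarForm A '' {δ | ∀ i, ‖δ i‖ ≤ 1})

/-! The suprema above are attained, so they are the maxima. -/

theorem isGreatest_of_isCompact {E : Type*} [TopologicalSpace E] {f : E → ℝ} {s : Set E}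
    (hs : IsCompact s) (hne : s.Nonempty) (hf : Continuous f) :
    IsGreatest (f '' s) (sSup (f '' s)) :=
  (hs.image hf).isGreatest_sSup (hne.image f)

theorem isCompact_pi_sphere {E : Type*} [NormedAddCommGroup E] [ProperSpace E] (n : ℕ) :
    IsCompact {x : Fin n → E | ∀ i, ‖x i‖ = 1} := by
  simpa [Set.pi] using
    isCompact_univ_pi (fun _ : Fin n => isCompact_sphere (0 : E) 1)

theorem isCompact_pi_ball {E : Type*} [NormedAddCommGroup E] [ProperSpace E] (n : ℕ) :
    IsCompact {x : Fin n → E | ∀ i, ‖x i‖ ≤ 1} := by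
  simpa [Set.pi] using
    isCompact_univ_pi (fun _ : Fin n => isCompact_closedBall (0 : E) 1)

theorem continuous_vectorForm {n : ℕ} (d : ℕ) (A : Matrix (Fin n) (Fin n) 𝕜) :
    Continuous (vectorForm d A) := by
  unfold vectorForm
  fun_prop

theorem continuous_scalarForm {n : ℕ} (A : Matrix (Fin n) (Fin n) 𝕜) :
    Continuous (scalarForm A) := by
  unfold scalarForm
  have h : Continuous (starRingEnd 𝕜) := RCLike.continuous_conj
  fun_prop

theorem isGreatest_gammaSeminorm {n d : ℕ} (hd : n ≤ d) (A : Matrix (Fin n) (Fin n) 𝕜) :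
    IsGreatest (vectorForm d A '' {x | ∀ i, ‖x i‖ = 1}) (gammaSeminorm d A) :=
  isGreatest_of_isCompact (isCompact_pi_sphere n)
    ⟨fun i => EuclideanSpace.single (Fin.castLE hd i) 1, fun i => by simp⟩
    (continuous_vectorForm d A)

theorem isGreatest_GammaNorm {n : ℕ} (d : ℕ) (A : Matrix (Fin n) (Fin n) 𝕜) :
    IsGreatest (vectorForm d A '' {x | ∀ i, ‖x i‖ ≤ 1}) (GammaNorm d A) :=
  isGreatest_of_isCompact (isCompact_pi_ball n) ⟨0, fun i => by simp⟩ (continuous_vectorForm d A)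

theorem isGreatest_thetaSeminorm {n : ℕ} (A : Matrix (Fin n) (Fin n) 𝕜) :
    IsGreatest (scalarForm A '' {δ | ∀ i, ‖δ i‖ = 1}) (thetaSeminorm A) :=
  isGreatest_of_isCompact (isCompact_pi_sphere n) ⟨fun _ => 1, fun i => by simp⟩
    (continuous_scalarForm A)

theorem isGreatest_ThetaNorm {n : ℕ} (A : Matrix (Fin n) (Fin n) 𝕜) :
    IsGreatest (scalarForm A '' {δ | ∀ i, ‖δ i‖ ≤ 1}) (ThetaNorm A) :=
  isGreatest_of_isCompact (isCompact_pi_ball n) ⟨0, fun i => by simp⟩ (continuous_scalarForm A)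

/-- The constants `K > 0` such that `‖A‖_γ ≤ K ‖A‖_θ` for all `n`, all `d ≥ n` and all
symmetric (Hermitian) `n × n` matrices `A` over `𝕜`. -/
def gammaConstants (𝕜 : Type*) [RCLike 𝕜] : Set ℝ :=
  {K | 0 < K ∧ ∀ n d : ℕ, n ≤ d → ∀ A : Matrix (Fin n) (Fin n) 𝕜, A.IsHermitian →
    gammaSeminorm d A ≤ K * thetaSeminorm A}

/-- The constants `K > 0` such that `‖A‖_Γ ≤ K ‖A‖_Θ` for all `n`, all `d ≥ n` and all
symmetric (Hermitian) `n × n` matrices `A` over `𝕜`. -/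
def GammaConstants (𝕜 : Type*) [RCLike 𝕜] : Set ℝ :=
  {K | 0 < K ∧ ∀ n d : ℕ, n ≤ d → ∀ A : Matrix (Fin n) (Fin n) 𝕜, A.IsHermitian →
    GammaNorm d A ≤ K * ThetaNorm A}

end SymmetricGrothendieck

end

/-! Call an array M a cut (`IsCut`) if it lies in the unit ball dual to ‖·‖_θ. Rank-one arrays
conj(δ_i) δ_j with unimodular δ are cuts, hence so are their averages, limits and conjugates and,
crucially, entrywise products of cuts (`IsCut.mul`). A constant K is admissible for ‖·‖_γ as soon as
every Gram matrix of unit vectors is a combination of cuts whose coefficients have absolute values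
summing to at most K.

Real case: for a Gaussian vector g the signs of ⟨x_i, g⟩ have correlations S_ij = (2/π) arcsin⟨x_i,
x_j⟩ (`integral_halfSign_inner_mul`), so S is a cut. The Gram matrix is sin(πS/2) entrywise, and the
sine series has absolute coefficient sum sinh(π/2).

Complex case: with z = ⟨x_i, x_j⟩, the phases of ⟨g, x_i⟩ have correlations (π/4) z F(|z|²), where F
= ₂F₁(1/2, 1/2; 2; ·) (`integral_conj_phase_mul_phase`), and F(1) = 4/π. Put F(t) = 1 + t H(t), so
that z = z F(|z|²) - z |z|² H(|z|²). The first term is 4/π times a cut. For the second, H = F³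
exp(Λ) / 8 on |t| < 1, where Λ has nonnegative coefficients (`powSum_haagerupCoeff_succ_eq`). The
factor z |z|² F³ is (4/π)³ times a product of three cuts, and each exp(c |z|^(2k) - c) with c ≥ 0 is
a product of Gaussian kernels, hence a cut. So the second term is a multiple of a cut; the multiple
is H(1) = 4/π - 1, and the total is 8/π - 1.

The hard point is that Λ has nonnegative coefficients. The coefficients y of F'/F satisfy a Riccati
recursion, whose estimates (`RiccatiSeq.increment`) feed a Kaluza-type lemma (`nonneg_of_conv_eq`)
for the quotient of power series defining t Λ'(t).

Finally, a constant valid for ‖·‖_γ is valid for ‖·‖_Γ because vector lengths can be absorbed into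
A, and least constants exist because the sets of admissible constants are closed and bounded below
by 1. -/

namespace SymmetricGrothendieck

open MeasureTheory Filter Topology
open scoped ComplexConjugate

/-! ### The dual unit ball of ‖·‖_θ -/

section Cut

variable {𝕜 : Type*} [RCLike 𝕜] {n : ℕ}

/-- The bilinear pairing `∑ a_ij m_ij`. -/
def pairing (A M : Fin n → Fin n → 𝕜) : 𝕜 := ∑ i, ∑ j, A i j * M i j

/-- The seminorm `‖A‖_θ` of an array of scalars. -/
noncomputable def theta (A : Fin n → Fin n → 𝕜) : ℝ := thetaSeminorm (Matrix.of A)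

/-- `M` lies in the unit ball of the dual of the seminorm `‖·‖_θ`. -/
def IsCut (M : Fin n → Fin n → 𝕜) : Prop :=
  ∀ A : Fin n → Fin n → 𝕜, ‖pairing A M‖ ≤ theta A

theorem scalarForm_eq_norm_pairing (A : Fin n → Fin n → 𝕜) (δ : Fin n → 𝕜) :
    scalarForm (Matrix.of A) δ = ‖pairing A (fun i j => conj (δ i) * δ j)‖ := by
  simp [scalarForm, pairing, mul_assoc]

theorem scalarForm_le_theta (A : Fin n → Fin n → 𝕜) {δ : Fin n → 𝕜}
    (hδ : ∀ i, ‖δ i‖ = 1) : scalarForm (Matrix.of A) δ ≤ theta A :=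
  (isGreatest_thetaSeminorm (Matrix.of A)).2 ⟨δ, hδ, rfl⟩

theorem theta_le {A : Fin n → Fin n → 𝕜} {C : ℝ}
    (h : ∀ δ : Fin n → 𝕜, (∀ i, ‖δ i‖ = 1) → scalarForm (Matrix.of A) δ ≤ C) : theta A ≤ C := by
  obtain ⟨δ, hδ, h'⟩ := (isGreatest_thetaSeminorm (Matrix.of A)).1
  exact h'.symm.trans_le (h δ hδ)

theorem isCut_rankOne {δ : Fin n → 𝕜} (hδ : ∀ i, ‖δ i‖ = 1) :
    IsCut (fun i j => conj (δ i) * δ j) := fun A => by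
  rw [← scalarForm_eq_norm_pairing]
  exact scalarForm_le_theta A hδ

theorem pairing_mul_right (A M N : Fin n → Fin n → 𝕜) :
    pairing A (fun i j => M i j * N i j) = pairing (fun i j => A i j * M i j) N := by
  simp [pairing, mul_assoc]

/-- The unit ball of the dual of `‖·‖_θ` is closed under Hadamard products. -/
theorem IsCut.mul {M N : Fin n → Fin n → 𝕜} (hM : IsCut M) (hN : IsCut N) :
    IsCut (fun i j => M i j * N i j) := fun A => by
  rw [pairing_mul_right]
  -- Pairing A with M∘N is pairing A∘M with N, so testing N only needs rank-one arrays from δ. The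
  -- same move for M leaves rank-one arrays from δ and ε, whose entrywise product is the rank-one
  -- array of δε.
  refine (hN _).trans (theta_le fun δ hδ => ?_)
  rw [scalarForm_eq_norm_pairing, ← pairing_mul_right]
  have : pairing A (fun i j => M i j * (conj (δ i) * δ j)) =
      pairing (fun i j => A i j * (conj (δ i) * δ j)) M := by
    simp only [pairing]
    exact Finset.sum_congr rfl fun i _ => Finset.sum_congr rfl fun j _ => by ring
  rw [this]
  refine (hM _).trans (theta_le fun ε hε => ?_)
  rw [scalarForm_eq_norm_pairing, ← pairing_mul_right]
  have := isCut_rankOne (δ := fun i => δ i * ε i) (fun i => by simp [hδ, hε]) A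
  convert this using 4
  funext j
  simp only [map_mul]
  ring

theorem isCut_one : IsCut (fun _ _ => 1 : Fin n → Fin n → 𝕜) := by
  simpa using isCut_rankOne (n := n) (δ := fun _ => (1 : 𝕜)) (by simp)

theorem IsCut.pow {M : Fin n → Fin n → 𝕜} (hM : IsCut M) (k : ℕ) :
    IsCut (fun i j => M i j ^ k) := by
  induction k with
  | zero => simpa using isCut_one
  | succ k ih => simpa [pow_succ] using ih.mul hM

theorem IsCut.prod {ι : Type*} {M : ι → Fin n → Fin n → 𝕜} (s : Finset ι)
    (hM : ∀ l ∈ s, IsCut (M l)) : IsCut (fun i j => ∏ l ∈ s, M l i j) := by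
  classical
  induction s using Finset.induction_on with
  | empty => simpa using isCut_one
  | insert a s ha ih =>
    simp only [Finset.prod_insert ha]
    exact (hM a (by simp)).mul (ih fun l hl => hM l (by simp [hl]))

theorem IsCut.conj {M : Fin n → Fin n → 𝕜} (hM : IsCut M) :
    IsCut (fun i j => conj (M i j)) := fun A => by
  have key : ∀ A N : Fin n → Fin n → 𝕜, ‖pairing A (fun i j => starRingEnd 𝕜 (N i j))‖ =
      ‖pairing (fun i j => starRingEnd 𝕜 (A i j)) N‖ := fun A N => by
    rw [← RCLike.norm_conj]
    simp [pairing]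
  rw [key]
  refine (hM _).trans (theta_le fun δ hδ => ?_)
  rw [scalarForm_eq_norm_pairing, ← key]
  simpa [mul_comm] using isCut_rankOne (δ := fun i => starRingEnd 𝕜 (δ i)) (by simpa using hδ) A

theorem tendsto_pairing {α : Type*} {l : Filter α} (A : Fin n → Fin n → 𝕜)
    {M : α → Fin n → Fin n → 𝕜} {N : Fin n → Fin n → 𝕜}
    (h : ∀ i j, Tendsto (fun r => M r i j) l (𝓝 (N i j))) :
    Tendsto (fun r => pairing A (M r)) l (𝓝 (pairing A N)) :=
  tendsto_finsetSum _ fun i _ => tendsto_finsetSum _ fun j _ => (h i j).const_mul _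

theorem isCut_of_tendsto {α : Type*} {l : Filter α} [l.NeBot]
    {M : α → Fin n → Fin n → 𝕜} {N : Fin n → Fin n → 𝕜}
    (hM : ∀ᶠ r in l, IsCut (M r))
    (h : ∀ i j, Tendsto (fun r => M r i j) l (𝓝 (N i j))) : IsCut N := fun A =>
  le_of_tendsto (tendsto_pairing A h).norm (hM.mono fun _ hr => hr A)

/-- Averages of rank-one unimodular matrices are cuts. -/
theorem isCut_integral {Ω : Type*} [MeasurableSpace Ω] (μ : Measure Ω) [IsProbabilityMeasure μ]
    {δ : Fin n → Ω → 𝕜} (hδ : ∀ i ω, ‖δ i ω‖ = 1) (hm : ∀ i, AEStronglyMeasurable (δ i) μ) :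
    IsCut (fun i j => ∫ ω, conj (δ i ω) * δ j ω ∂μ) := fun A => by
  have hint : ∀ i j, Integrable (fun ω => conj (δ i ω) * δ j ω) μ := fun i j => by
    refine Integrable.of_bound
      ((RCLike.continuous_conj.comp_aestronglyMeasurable (hm i)).mul (hm j)) 1 (ae_of_all _ ?_)
    simp [hδ]
  have : pairing A (fun i j => ∫ ω, conj (δ i ω) * δ j ω ∂μ) =
      ∫ ω, pairing A (fun i j => conj (δ i ω) * δ j ω) ∂μ := by
    simp only [pairing]
    rw [integral_finsetSum _ fun i _ => integrable_finsetSum _ fun j _ => (hint i j).const_mul _]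
    refine Finset.sum_congr rfl fun i _ => ?_
    rw [integral_finsetSum _ fun j _ => (hint i j).const_mul _]
    exact Finset.sum_congr rfl fun j _ => (integral_const_mul _ _).symm
  rw [this]
  refine (norm_integral_le_of_norm_le_const (C := theta A) (ae_of_all _ fun ω => ?_)).trans
    (by simp)
  exact isCut_rankOne (fun i => hδ i ω) A

/-- An absolutely convergent combination of cuts is bounded by the sum of the coefficients. -/
theorem norm_pairing_le_of_hasSum {M : ℕ → Fin n → Fin n → 𝕜}
    {N : Fin n → Fin n → 𝕜} {c : ℕ → 𝕜} {C : ℝ} (hM : ∀ k, IsCut (M k))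
    (hN : ∀ i j, HasSum (fun k => c k * M k i j) (N i j)) (hc : HasSum (fun k => ‖c k‖) C)
    (A : Fin n → Fin n → 𝕜) : ‖pairing A N‖ ≤ C * theta A := by
  have h : HasSum (fun k => c k * pairing A (M k)) (pairing A N) := by
    have : ∀ k, c k * pairing A (M k) = ∑ i, ∑ j, A i j * (c k * M k i j) := fun k => by
      simp only [pairing, Finset.mul_sum]
      exact Finset.sum_congr rfl fun i _ => Finset.sum_congr rfl fun j _ => by ring
    simp only [this]
    exact hasSum_sum fun i _ => hasSum_sum fun j _ => (hN i j).mul_left _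
  rw [← h.tsum_eq]
  refine tsum_of_norm_bounded (hc.mul_right (theta A)) fun k => ?_
  rw [norm_mul]
  exact mul_le_mul_of_nonneg_left (hM k A) (norm_nonneg _)

end Cut

/-! ### From one admissible constant to the least constants -/

section Constants

variable {𝕜 : Type*} [RCLike 𝕜] {n : ℕ}

theorem vectorForm_eq_norm_pairing (d : ℕ) (A : Matrix (Fin n) (Fin n) 𝕜)
    (x : Fin n → EuclideanSpace 𝕜 (Fin d)) :
    vectorForm d A x = ‖pairing A (fun i j => inner 𝕜 (x i) (x j))‖ := rfl

theorem mem_gammaConstants_of_forall {K : ℝ} (hK : 0 < K)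
    (h : ∀ (n d : ℕ) (A : Fin n → Fin n → 𝕜) (x : Fin n → EuclideanSpace 𝕜 (Fin d)),
      (∀ i, ‖x i‖ = 1) → ‖pairing A (fun i j => inner 𝕜 (x i) (x j))‖ ≤ K * theta A) :
    K ∈ gammaConstants 𝕜 := by
  refine ⟨hK, fun n d hd A _ => ?_⟩
  obtain ⟨x, hx, hA⟩ := (isGreatest_gammaSeminorm hd A).1
  rw [← hA, vectorForm_eq_norm_pairing]
  exact h n d A x hx

theorem one_le_of_mem_gammaConstants {K : ℝ} (hK : K ∈ gammaConstants 𝕜) : 1 ≤ K := by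
  have h := hK.2 1 1 le_rfl 1 Matrix.isHermitian_one
  have h1 : thetaSeminorm (1 : Matrix (Fin 1) (Fin 1) 𝕜) ≤ 1 := theta_le fun δ hδ => by
    simp [scalarForm, hδ]
  have h2 : 1 ≤ gammaSeminorm 1 (1 : Matrix (Fin 1) (Fin 1) 𝕜) := by
    refine (isGreatest_gammaSeminorm le_rfl _).2 ⟨fun _ => EuclideanSpace.single 0 1, by simp, ?_⟩
    simp [vectorForm]
  nlinarith [hK.1]

theorem one_le_of_mem_GammaConstants {K : ℝ} (hK : K ∈ GammaConstants 𝕜) : 1 ≤ K := by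
  have h := hK.2 1 1 le_rfl 1 Matrix.isHermitian_one
  have h1 : ThetaNorm (1 : Matrix (Fin 1) (Fin 1) 𝕜) ≤ 1 := by
    obtain ⟨δ, hδ, h'⟩ := (isGreatest_ThetaNorm (1 : Matrix (Fin 1) (Fin 1) 𝕜)).1
    have h0 : ‖δ 0‖ ≤ 1 := hδ 0
    rw [← h']
    simpa [scalarForm] using mul_le_one₀ h0 (norm_nonneg _) h0
  have h2 : 1 ≤ GammaNorm 1 (1 : Matrix (Fin 1) (Fin 1) 𝕜) := by
    refine (isGreatest_GammaNorm _ _).2 ⟨fun _ => EuclideanSpace.single 0 1, by simp, ?_⟩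
    simp [vectorForm]
  nlinarith [hK.1]

theorem thetaSeminorm_scale_le_ThetaNorm (A : Matrix (Fin n) (Fin n) 𝕜) {r : Fin n → ℝ}
    (hr0 : ∀ i, 0 ≤ r i) (hr1 : ∀ i, r i ≤ 1) :
    theta (fun i j => (r i : 𝕜) * A i j * (r j : 𝕜)) ≤ ThetaNorm A := by
  refine theta_le fun δ hδ => ?_
  refine (isGreatest_ThetaNorm A).2 ⟨fun i => (r i : 𝕜) * δ i, fun i => ?_, ?_⟩
  · simpa [hδ, abs_of_nonneg (hr0 i)] using hr1 i
  · simp only [scalarForm, map_mul, RCLike.conj_ofReal, Matrix.of_apply]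
    congr 1
    exact Finset.sum_congr rfl fun i _ => Finset.sum_congr rfl fun j _ => by ring

/-- Write a maximizing family as x_i = ‖x_i‖ y_i with unit y_i and move the lengths into the matrix.
The rescaled matrix stays Hermitian, and its θ-seminorm is at most ‖A‖_Θ because the lengths are at
most 1. -/
theorem gammaConstants_subset_GammaConstants : gammaConstants 𝕜 ⊆ GammaConstants 𝕜 := by
  rintro K ⟨hK, h⟩
  refine ⟨hK, fun n d hd A hA => ?_⟩
  obtain ⟨x, hx, hxA⟩ := (isGreatest_GammaNorm d A).1
  -- A zero vector has no direction, so any unit vector may stand in for it; `n ≤ d` supplies one.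
  let e : Fin n → EuclideanSpace 𝕜 (Fin d) := fun i => EuclideanSpace.single (Fin.castLE hd i) 1
  let y : Fin n → EuclideanSpace 𝕜 (Fin d) := fun i =>
    if x i = 0 then e i else ((‖x i‖⁻¹ : ℝ) : 𝕜) • x i
  have hy : ∀ i, ‖y i‖ = 1 := fun i => by
    by_cases hi : x i = 0
    · simp [y, hi, e]
    · simp [y, hi, norm_smul]
  have hxy : ∀ i, x i = ((‖x i‖ : ℝ) : 𝕜) • y i := fun i => by
    by_cases hi : x i = 0
    · simp [hi]
    · have : (‖x i‖ : 𝕜) ≠ 0 := by simpa using hi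
      simp [y, hi, smul_smul, this]
  let B : Matrix (Fin n) (Fin n) 𝕜 := Matrix.of fun i j => (‖x i‖ : 𝕜) * A i j * (‖x j‖ : 𝕜)
  have hB : B.IsHermitian := by
    ext i j
    have := hA.apply i j
    simp only [Matrix.conjTranspose_apply, B, Matrix.of_apply, star_mul, RCLike.star_def,
      RCLike.conj_ofReal] at this ⊢
    rw [this]
    ring
  have h1 : vectorForm d A x = vectorForm d B y := by
    simp only [vectorForm]
    congr 1
    refine Finset.sum_congr rfl fun i _ => Finset.sum_congr rfl fun j _ => ?_
    conv_lhs => rw [hxy i, hxy j]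
    simp only [inner_smul_left, inner_smul_right, RCLike.conj_ofReal, B, Matrix.of_apply]
    ring
  rw [← hxA, h1]
  calc vectorForm d B y ≤ gammaSeminorm d B := (isGreatest_gammaSeminorm hd B).2 ⟨y, hy, rfl⟩
    _ ≤ K * thetaSeminorm B := h n d hd B hB
    _ ≤ K * ThetaNorm A := by
      gcongr
      exact thetaSeminorm_scale_le_ThetaNorm A (fun i => norm_nonneg _) hx

theorem isLeast_csInf_of_one_le {S : Set ℝ} (hne : S.Nonempty) (hcl : IsClosed S)
    (h : ∀ K ∈ S, 1 ≤ K) : IsLeast S (sInf S) :=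
  hcl.isLeast_csInf hne ⟨1, h⟩

/-- The strict condition 0 < K is not closed, but the 1 × 1 identity matrix forces 1 ≤ K, which is.
-/
theorem isClosed_gammaConstants : IsClosed (gammaConstants 𝕜) := by
  have : gammaConstants 𝕜 = Set.Ici 1 ∩ {K | ∀ n d : ℕ, n ≤ d →
      ∀ A : Matrix (Fin n) (Fin n) 𝕜, A.IsHermitian →
        gammaSeminorm d A ≤ K * thetaSeminorm A} := by
    ext K
    exact ⟨fun h => ⟨one_le_of_mem_gammaConstants h, h.2⟩,
      fun h => ⟨zero_lt_one.trans_le h.1, h.2⟩⟩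
  rw [this]
  refine isClosed_Ici.inter ?_
  simp only [Set.ofPred_forall]
  exact isClosed_iInter fun n => isClosed_iInter fun d => isClosed_iInter fun _ =>
    isClosed_iInter fun A => isClosed_iInter fun _ =>
      isClosed_le continuous_const (continuous_id.mul continuous_const)

theorem isClosed_GammaConstants : IsClosed (GammaConstants 𝕜) := by
  have : GammaConstants 𝕜 = Set.Ici 1 ∩ {K | ∀ n d : ℕ, n ≤ d →
      ∀ A : Matrix (Fin n) (Fin n) 𝕜, A.IsHermitian →
        GammaNorm d A ≤ K * ThetaNorm A} := by
    ext K
    exact ⟨fun h => ⟨one_le_of_mem_GammaConstants h, h.2⟩,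
      fun h => ⟨zero_lt_one.trans_le h.1, h.2⟩⟩
  rw [this]
  refine isClosed_Ici.inter ?_
  simp only [Set.ofPred_forall]
  exact isClosed_iInter fun n => isClosed_iInter fun d => isClosed_iInter fun _ =>
    isClosed_iInter fun A => isClosed_iInter fun _ =>
      isClosed_le continuous_const (continuous_id.mul continuous_const)

/-- One admissible constant yields the two smallest constants and their ordering. -/
theorem exists_isLeast_constants {K : ℝ} (hK : K ∈ gammaConstants 𝕜) :
    ∃ Kγ KΓ : ℝ, IsLeast (gammaConstants 𝕜) Kγ ∧ IsLeast (GammaConstants 𝕜) KΓ ∧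
      KΓ ≤ Kγ ∧ Kγ ≤ K := by
  have hγ := isLeast_csInf_of_one_le ⟨K, hK⟩ isClosed_gammaConstants
    fun K => one_le_of_mem_gammaConstants (𝕜 := 𝕜)
  have hΓ := isLeast_csInf_of_one_le ⟨K, gammaConstants_subset_GammaConstants hK⟩
    isClosed_GammaConstants fun K => one_le_of_mem_GammaConstants (𝕜 := 𝕜)
  exact ⟨_, _, hγ, hΓ, hΓ.2 (gammaConstants_subset_GammaConstants hγ.1), hγ.2 hK⟩

end Constants

end SymmetricGrothendieck

namespace SymmetricGrothendieck

open MeasureTheory Filter Topology ProbabilityTheory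
open scoped ComplexConjugate Real

/-! ### Correlation of the signs of two shifted cosines -/

section Sign

/-- The sign of a real number, with value `1` at `0`. -/
noncomputable def halfSign (t : ℝ) : ℝ := if 0 ≤ t then 1 else -1

theorem halfSign_of_nonneg {t : ℝ} (h : 0 ≤ t) : halfSign t = 1 := if_pos h

theorem halfSign_of_neg {t : ℝ} (h : t < 0) : halfSign t = -1 := if_neg h.not_ge

theorem abs_halfSign (t : ℝ) : |halfSign t| = 1 := by
  unfold halfSign
  split_ifs <;> simp

@[fun_prop]
theorem measurable_halfSign : Measurable halfSign :=
  Measurable.ite measurableSet_Ici measurable_const measurable_const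

theorem halfSign_mul_of_pos {r : ℝ} (hr : 0 < r) (t : ℝ) : halfSign (r * t) = halfSign t := by
  simp [halfSign, mul_nonneg_iff_of_pos_left hr]

theorem intervalIntegral_of_eqOn_Ioo {f : ℝ → ℝ} {a b c : ℝ} (hab : a ≤ b)
    (h : ∀ t ∈ Set.Ioo a b, f t = c) : ∫ t in a..b, f t = (b - a) * c := by
  rw [intervalIntegral.integral_of_le hab, integral_Ioc_eq_integral_Ioo,
    setIntegral_congr_fun measurableSet_Ioo h]
  simp [hab]

theorem intervalIntegrable_of_abs_le {f : ℝ → ℝ} (hf : Measurable f) {C : ℝ} (h : ∀ t, |f t| ≤ C)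
    (a b : ℝ) : IntervalIntegrable f volume a b := by
  rw [intervalIntegrable_iff]
  have : IsFiniteMeasure (volume.restrict (Set.uIoc a b)) := by
    unfold Set.uIoc
    infer_instance
  exact Integrable.of_bound hf.aestronglyMeasurable C (ae_of_all _ h)

/-- On the period starting at -π/2 the product changes sign only at α - π/2, π/2 and α + π/2. The
pieces have lengths α, π - α, α, π - α and signs -, +, -, +. -/
theorem integral_halfSign_cos_mul {α : ℝ} (h0 : 0 ≤ α) (hπ : α ≤ π) :
    ∫ φ in (-(π / 2))..(3 * π / 2), halfSign (Real.cos φ) * halfSign (Real.cos (φ - α)) =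
      2 * π - 4 * α := by
  have hpi := Real.pi_pos
  set f : ℝ → ℝ := fun φ => halfSign (Real.cos φ) * halfSign (Real.cos (φ - α)) with hf
  have hi : ∀ a b, IntervalIntegrable f volume a b := intervalIntegrable_of_abs_le
    (by fun_prop) (C := 1) (fun t => by simp [hf, abs_mul, abs_halfSign])
  have hneg : ∀ t : ℝ, -(3 * π / 2) < t → t < -(π / 2) → Real.cos t < 0 := fun t h1 h2 => by
    rw [← Real.cos_neg]
    exact Real.cos_neg_of_pi_div_two_lt_of_lt (by linarith) (by linarith)
  have hpos : ∀ t : ℝ, -(π / 2) < t → t < π / 2 → 0 ≤ Real.cos t := fun t h1 h2 =>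
    (Real.cos_pos_of_mem_Ioo ⟨h1, h2⟩).le
  have hneg' : ∀ t : ℝ, π / 2 < t → t < 3 * π / 2 → Real.cos t < 0 := fun t h1 h2 =>
    Real.cos_neg_of_pi_div_two_lt_of_lt h1 (by linarith)
  rw [← intervalIntegral.integral_add_adjacent_intervals (hi _ (α - π / 2)) (hi _ _),
    ← intervalIntegral.integral_add_adjacent_intervals (hi (α - π / 2) (π / 2)) (hi _ _),
    ← intervalIntegral.integral_add_adjacent_intervals (hi (π / 2) (α + π / 2)) (hi _ _),
    intervalIntegral_of_eqOn_Ioo (c := -1) (by linarith) fun t ht => ?_,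
    intervalIntegral_of_eqOn_Ioo (c := 1) (by linarith) fun t ht => ?_,
    intervalIntegral_of_eqOn_Ioo (c := -1) (by linarith) fun t ht => ?_,
    intervalIntegral_of_eqOn_Ioo (c := 1) (by linarith) fun t ht => ?_]
  · ring
  all_goals obtain ⟨h1, h2⟩ := ht
  · simp only [hf]
    rw [halfSign_of_neg (hneg' t (by linarith) (by linarith)),
      halfSign_of_neg (hneg' _ (by linarith) (by linarith))]
    norm_num
  · simp only [hf]
    rw [halfSign_of_neg (hneg' t (by linarith) (by linarith)),
      halfSign_of_nonneg (hpos _ (by linarith) (by linarith))]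
    norm_num
  · simp only [hf]
    rw [halfSign_of_nonneg (hpos t (by linarith) (by linarith)),
      halfSign_of_nonneg (hpos _ (by linarith) (by linarith))]
    norm_num
  · simp only [hf]
    rw [halfSign_of_nonneg (hpos t (by linarith) (by linarith)),
      halfSign_of_neg (hneg _ (by linarith) (by linarith))]
    norm_num

end Sign

/-! ### Gaussian vectors and Grothendieck's identity -/

section Gaussian

variable {E : Type*} [NormedAddCommGroup E] [InnerProductSpace ℝ E] [FiniteDimensional ℝ E]
  [MeasurableSpace E] [BorelSpace E]
variable {E' : Type*} [NormedAddCommGroup E'] [InnerProductSpace ℝ E'] [FiniteDimensional ℝ E']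
  [MeasurableSpace E'] [BorelSpace E']

/-- The pair `(⟪x, g⟫, ⟪y, g⟫)` as a complex number. -/
noncomputable def innerPair (x y g : E) : ℂ := ⟨inner ℝ x g, inner ℝ y g⟩

theorem innerPair_eq {F : Type*} [NormedAddCommGroup F] [InnerProductSpace ℝ F] (x y g : F) :
    innerPair x y g = ((inner ℝ x g : ℝ) : ℂ) + ((inner ℝ y g : ℝ) : ℂ) * Complex.I := by
  apply Complex.ext <;> simp [innerPair]

@[fun_prop]
theorem continuous_innerPair {F : Type*} [NormedAddCommGroup F] [InnerProductSpace ℝ F] (x y : F) :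
    Continuous (innerPair x y) := by
  have : innerPair x y = fun g =>
      ((inner ℝ x g : ℝ) : ℂ) + ((inner ℝ y g : ℝ) : ℂ) * Complex.I := funext (innerPair_eq x y)
  rw [this]
  fun_prop

theorem charFun_map_innerPair (x y : E) (t : ℂ) :
    charFun ((stdGaussian E).map (innerPair x y)) t =
      Complex.exp (-‖t.re • x + t.im • y‖ ^ 2 / 2) := by
  rw [← charFun_stdGaussian, charFun_apply, charFun_apply,
    integral_map (by fun_prop) (by fun_prop)]
  congr 1
  funext g
  congr 3
  simp [innerPair, Complex.inner, inner_add_right, inner_smul_right, real_inner_comm]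
  ring

/-- The law of `(⟪x, g⟫, ⟪y, g⟫)` depends only on the Gram matrix of `x, y`. -/
theorem map_innerPair_eq {x y : E} {x' y' : E'} (hx : ‖x‖ = ‖x'‖) (hy : ‖y‖ = ‖y'‖)
    (hxy : inner ℝ x y = inner ℝ x' y') :
    (stdGaussian E).map (innerPair x y) = (stdGaussian E').map (innerPair x' y') := by
  have := Measure.isProbabilityMeasure_map (μ := stdGaussian E) (f := innerPair x y)
    (by fun_prop)
  have := Measure.isProbabilityMeasure_map (μ := stdGaussian E') (f := innerPair x' y')
    (by fun_prop)
  refine Measure.ext_of_charFun (funext fun t => ?_)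
  rw [charFun_map_innerPair, charFun_map_innerPair]
  have : ‖t.re • x + t.im • y‖ ^ 2 = ‖t.re • x' + t.im • y'‖ ^ 2 := by
    simp only [norm_add_sq_real, norm_smul, inner_smul_left, inner_smul_right, hx, hy, hxy]
  norm_cast
  rw [this]

theorem stdGaussian_inner_eq_zero {x : E} (hx : ‖x‖ = 1) :
    ∀ᵐ g ∂(stdGaussian E), inner ℝ x g ≠ 0 := by
  have h : (stdGaussian E).map (fun g => inner ℝ x g) = gaussianReal 0 1 := by
    have := Measure.isProbabilityMeasure_map (μ := stdGaussian E) (f := fun g => inner ℝ x g)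
      (by fun_prop)
    refine Measure.ext_of_charFun (funext fun t => ?_)
    have := charFun_stdGaussian (E := E) (t • x)
    rw [charFun_gaussianReal, charFun_apply, integral_map (by fun_prop) (by fun_prop)]
    rw [charFun_apply] at this
    convert this using 1
    · congr 1
      funext g
      simp [inner_smul_right, real_inner_comm]
    · simp [norm_smul, hx, ← Complex.ofReal_pow, neg_div]
  have hatom : gaussianReal 0 1 {0} = 0 := by
    have := nullSingletonClass_gaussianReal (μ := 0) (v := 1) one_ne_zero
    exact measure_singleton 0
  rw [← h, Measure.map_apply (by fun_prop) (measurableSet_singleton 0)] at hatom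
  exact measure_eq_zero_iff_ae_notMem.1 hatom

/-- In polar form the integrand depends on z only through the shift φ + arg z, which periodicity
removes. -/
theorem integral_halfSign_rotation (α : ℝ) (h0 : 0 ≤ α) (hπ : α ≤ π) {z : ℂ} (hz : z ≠ 0) :
    ∫ φ in (0 : ℝ)..(2 * π), halfSign (Complex.exp (φ * Complex.I) * z).re *
      halfSign (Complex.exp (-α * Complex.I) * (Complex.exp (φ * Complex.I) * z)).re =
      2 * π - 4 * α := by
  rw [← integral_halfSign_cos_mul h0 hπ]
  have hz' : 0 < ‖z‖ := norm_pos_iff.2 hz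
  have key : ∀ φ : ℝ, halfSign (Complex.exp (φ * Complex.I) * z).re *
      halfSign (Complex.exp (-α * Complex.I) * (Complex.exp (φ * Complex.I) * z)).re =
      (fun φ => halfSign (Real.cos φ) * halfSign (Real.cos (φ - α))) (φ + z.arg) := fun φ => by
    have h1 : Complex.exp (φ * Complex.I) * z =
        ‖z‖ * Complex.exp (((φ + z.arg : ℝ) : ℂ) * Complex.I) := by
      conv_lhs => rw [← Complex.norm_mul_exp_arg_mul_I z]
      push_cast
      rw [add_mul, Complex.exp_add]
      ring
    have h2 : Complex.exp (-α * Complex.I) * (Complex.exp (φ * Complex.I) * z) =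
        ‖z‖ * Complex.exp (((φ + z.arg - α : ℝ) : ℂ) * Complex.I) := by
      rw [h1]
      push_cast
      rw [sub_mul, Complex.exp_sub, neg_mul, Complex.exp_neg]
      field_simp
    rw [h2, h1, Complex.re_ofReal_mul, Complex.re_ofReal_mul, Complex.exp_ofReal_mul_I_re,
      Complex.exp_ofReal_mul_I_re, halfSign_mul_of_pos hz', halfSign_mul_of_pos hz']
  simp only [key]
  rw [intervalIntegral.integral_comp_add_right
    (fun φ => halfSign (Real.cos φ) * halfSign (Real.cos (φ - α)))]
  have hper : Function.Periodic
      (fun φ => halfSign (Real.cos φ) * halfSign (Real.cos (φ - α))) (2 * π) := fun φ => by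
    simp only
    rw [Real.cos_add_two_pi, show φ + 2 * π - α = φ - α + 2 * π by ring, Real.cos_add_two_pi]
  have := hper.intervalIntegral_add_eq (0 + z.arg) (-(π / 2))
  convert this using 2 <;> ring

/-- The Gaussian law on ℂ is rotation invariant, so the integral equals its average over all
rotations. After Fubini the average over angles is the same constant for every z ≠ 0. -/
theorem integral_halfSign_complex {α : ℝ} (h0 : 0 ≤ α) (hπ : α ≤ π) :
    ∫ z, halfSign z.re * halfSign (Complex.exp (-α * Complex.I) * z).re ∂(stdGaussian ℂ) =
      1 - 2 * α / π := by
  set f : ℂ → ℝ := fun z => halfSign z.re * halfSign (Complex.exp (-α * Complex.I) * z).re with hf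
  have hfm : Measurable f := by fun_prop
  have hfb : ∀ z, ‖f z‖ ≤ 1 := fun z => by simp [hf, abs_halfSign]
  have hrot : ∀ φ : ℝ, ∫ z, f (Complex.exp (φ * Complex.I) * z) ∂(stdGaussian ℂ) =
      ∫ z, f z ∂(stdGaussian ℂ) := fun φ => by
    have hm := stdGaussian_map (rotation (Circle.exp φ))
    conv_rhs => rw [← hm]
    rw [integral_map (by fun_prop) hfm.aestronglyMeasurable]
    simp [rotation_apply]
  have hz : ∀ᵐ z ∂(stdGaussian ℂ), z ≠ 0 := by
    filter_upwards [stdGaussian_inner_eq_zero (E := ℂ) (x := 1) (by simp)] with z h h0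
    simp [h0] at h
  have hpi := Real.pi_pos
  have h1 : ∫ φ in (0 : ℝ)..(2 * π), ∫ z, f (Complex.exp (φ * Complex.I) * z) ∂(stdGaussian ℂ) =
      ∫ z, (∫ φ in (0 : ℝ)..(2 * π), f (Complex.exp (φ * Complex.I) * z)) ∂(stdGaussian ℂ) := by
    have : IsFiniteMeasure (volume.restrict (Set.uIoc 0 (2 * π))) := by
      unfold Set.uIoc
      infer_instance
    refine intervalIntegral_integral_swap ?_
    exact Integrable.of_bound (Measurable.aestronglyMeasurable (by fun_prop)) 1
      (ae_of_all _ fun p => hfb _)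
  simp only [hrot] at h1
  rw [integral_congr_ae (g := fun _ => 2 * π - 4 * α)
      (f := fun z => ∫ φ in (0 : ℝ)..(2 * π), f (Complex.exp (φ * Complex.I) * z)) (by
    filter_upwards [hz] with z hz
    exact integral_halfSign_rotation α h0 hπ hz)] at h1
  simp only [intervalIntegral.integral_const, sub_zero, smul_eq_mul, integral_const,
    probReal_univ, one_mul] at h1
  field_simp
  linarith

/-- **Grothendieck's identity**. -/
theorem integral_halfSign_inner_mul {x y : E} (hx : ‖x‖ = 1) (hy : ‖y‖ = 1) :
    ∫ g, halfSign (inner ℝ x g) * halfSign (inner ℝ y g) ∂(stdGaussian E) =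
      2 / π * Real.arcsin (inner ℝ x y) := by
  set α := Real.arccos (inner ℝ x y) with hα
  have habs := abs_le.1 (abs_real_inner_le_norm x y)
  rw [hx, hy] at habs
  -- Only the angle α between x and y matters, so the pair x, y may be replaced by 1 and exp(iα) in
  -- the real plane ℂ.
  have hlaw := map_innerPair_eq (E := E) (E' := ℂ) (x := x) (y := y) (x' := 1)
    (y' := Complex.exp (α * Complex.I)) (by simp [hx]) (by simp [hy, Complex.norm_exp_ofReal_mul_I])
    (by simp [Complex.inner, Complex.exp_ofReal_mul_I_re, hα,
      Real.cos_arccos (by linarith [habs.1] : -1 ≤ inner ℝ x y) (by linarith [habs.2])])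
  have hF : Measurable (fun w : ℂ => halfSign w.re * halfSign w.im) := by fun_prop
  calc ∫ g, halfSign (inner ℝ x g) * halfSign (inner ℝ y g) ∂(stdGaussian E)
      = ∫ w, halfSign w.re * halfSign w.im ∂((stdGaussian E).map (innerPair x y)) := by
        rw [integral_map (by fun_prop) hF.aestronglyMeasurable]
        rfl
    _ = ∫ z, halfSign z.re * halfSign (Complex.exp (-α * Complex.I) * z).re ∂(stdGaussian ℂ) := by
        rw [hlaw, integral_map (by fun_prop) hF.aestronglyMeasurable]
        congr 1
        funext z
        have : conj (Complex.exp (α * Complex.I)) = Complex.exp (-α * Complex.I) := by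
          rw [← Complex.exp_conj]
          simp
        simp only [innerPair, Complex.inner, this, map_one, one_mul, mul_comm z]
    _ = 1 - 2 * α / π := integral_halfSign_complex (Real.arccos_nonneg _) (Real.arccos_le_pi _)
    _ = _ := by
        rw [hα, Real.arccos]
        field_simp
        ring

end Gaussian

/-! ### The real constant sinh(π/2) -/

section RealCase

theorem isCut_arcsin {n d : ℕ} {x : Fin n → EuclideanSpace ℝ (Fin d)} (hx : ∀ i, ‖x i‖ = 1) :
    IsCut (fun i j => 2 / π * Real.arcsin (inner ℝ (x i) (x j))) := by
  -- The convention that `halfSign` is 1 at 0 makes these scalars unimodular at every g, not merely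
  -- almost everywhere.
  have := isCut_integral (𝕜 := ℝ) (stdGaussian (EuclideanSpace ℝ (Fin d)))
    (δ := fun i g => halfSign (inner ℝ (x i) g)) (fun i g => abs_halfSign _)
    (fun i => Measurable.aestronglyMeasurable (by fun_prop))
  simpa only [conj_trivial, integral_halfSign_inner_mul (hx _) (hx _)] using this

theorem sinh_pi_div_two_mem_gammaConstants : Real.sinh (π / 2) ∈ gammaConstants ℝ := by
  refine mem_gammaConstants_of_forall (Real.sinh_pos_iff.2 (by positivity)) fun n d A x hx => ?_
  have hcut := isCut_arcsin hx
  -- The inner product is sin(π/2 · s) with s the cut entry. Without their signs, the sine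
  -- coefficients at π/2 are those of sinh(π/2).
  refine norm_pairing_le_of_hasSum (M := fun k i j =>
    (2 / π * Real.arcsin (inner ℝ (x i) (x j))) ^ (2 * k + 1))
    (c := fun k => (-1) ^ k * (π / 2) ^ (2 * k + 1) / (2 * k + 1).factorial)
    (fun k => hcut.pow _) (fun i j => ?_) ?_ A
  · have habs := abs_le.1 (abs_real_inner_le_norm (x i) (x j))
    rw [hx, hx, one_mul] at habs
    have := Real.hasSum_sin (Real.arcsin (inner ℝ (x i) (x j)))
    rw [Real.sin_arcsin habs.1 habs.2] at this
    convert! this using 1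
    funext k
    rw [div_mul_eq_mul_div, mul_assoc, ← mul_pow]
    congr 3
    field_simp
  · convert! Real.hasSum_sinh (π / 2) using 1
    funext k
    simp [abs_of_pos Real.pi_pos]

end RealCase

end SymmetricGrothendieck

namespace SymmetricGrothendieck

open MeasureTheory Filter Topology
open scoped ComplexConjugate Real

/-! ### Power series with polynomially bounded coefficients -/

section PowerSums

/-- Polynomial growth of a coefficient sequence. -/
def Tame (f : ℕ → ℝ) : Prop := ∃ (C : ℝ) (m : ℕ), ∀ k, |f k| ≤ C * (k + 1) ^ m

/-- The sum of the power series with coefficients `f`. -/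
noncomputable def powSum (f : ℕ → ℝ) (t : ℝ) : ℝ := ∑' k, f k * t ^ k

/-- The coefficients of the derivative. -/
def shiftDeriv (f : ℕ → ℝ) (k : ℕ) : ℝ := (k + 1) * f (k + 1)

theorem tame_of_abs_le {f : ℕ → ℝ} {C : ℝ} (h : ∀ k, |f k| ≤ C) : Tame f :=
  ⟨C, 0, fun k => by simpa using h k⟩

theorem Tame.shiftDeriv {f : ℕ → ℝ} (hf : Tame f) : Tame (shiftDeriv f) := by
  obtain ⟨C, m, h⟩ := hf
  have hC : 0 ≤ C := by simpa using (abs_nonneg _).trans (h 0)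
  refine ⟨C * 2 ^ m, m + 1, fun k => ?_⟩
  have h1 := h (k + 1)
  push_cast at h1
  calc |((k : ℝ) + 1) * f (k + 1)| = (k + 1) * |f (k + 1)| := by
        rw [abs_mul, abs_of_nonneg (by positivity : (0 : ℝ) ≤ k + 1)]
    _ ≤ (k + 1) * (C * (k + 1 + 1) ^ m) := by gcongr
    _ ≤ (k + 1) * (C * (2 * (k + 1)) ^ m) := by
        gcongr
        linarith [(Nat.cast_nonneg k : (0 : ℝ) ≤ k)]
    _ = C * 2 ^ m * (k + 1) ^ (m + 1) := by rw [mul_pow]; ring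

theorem summable_succ_pow_mul_geometric (m : ℕ) {r : ℝ} (h0 : 0 < r) (h1 : r < 1) :
    Summable fun k : ℕ => ((k : ℝ) + 1) ^ m * r ^ k := by
  have h := summable_pow_mul_geometric_of_norm_lt_one (R := ℝ) m
    (r := r) (by rwa [Real.norm_of_nonneg h0.le])
  have h' := ((summable_nat_add_iff 1).2 h).mul_right r⁻¹
  refine h'.congr fun k => ?_
  push_cast
  rw [pow_succ, mul_assoc, mul_assoc, mul_inv_cancel₀ h0.ne', mul_one]

theorem exists_between_abs_one {t : ℝ} (ht : |t| < 1) : ∃ r, 0 < r ∧ r < 1 ∧ |t| < r := by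
  obtain ⟨r, h1, h2⟩ := exists_between ht
  exact ⟨r, (abs_nonneg t).trans_lt h1, h2, h1⟩

theorem Tame.summable_norm {f : ℕ → ℝ} (hf : Tame f) {t : ℝ} (ht : |t| < 1) :
    Summable fun k => ‖f k * t ^ k‖ := by
  obtain ⟨C, m, h⟩ := hf
  obtain ⟨r, h0, h1, h2⟩ := exists_between_abs_one ht
  refine Summable.of_nonneg_of_le (fun k => norm_nonneg _) (fun k => ?_)
    ((summable_succ_pow_mul_geometric m h0 h1).mul_left C)
  rw [norm_mul, norm_pow, Real.norm_eq_abs, Real.norm_eq_abs, ← mul_assoc]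
  exact mul_le_mul (h k) (pow_le_pow_left₀ (abs_nonneg _) h2.le k) (by positivity)
    ((abs_nonneg _).trans (h k))

theorem Tame.summable {f : ℕ → ℝ} (hf : Tame f) {t : ℝ} (ht : |t| < 1) :
    Summable fun k => f k * t ^ k := (hf.summable_norm ht).of_norm

theorem powSum_zero (f : ℕ → ℝ) : powSum f 0 = f 0 := by
  unfold powSum
  rw [tsum_eq_single 0 fun k hk => by simp [hk]]
  simp

theorem Tame.hasDerivAt {f : ℕ → ℝ} (hf : Tame f) {t : ℝ} (ht : |t| < 1) :
    HasDerivAt (powSum f) (powSum (SymmetricGrothendieck.shiftDeriv f) t) t := by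
  obtain ⟨r, h0, h1, h2⟩ := exists_between_abs_one ht
  have hr : |r| < 1 := by rwa [abs_of_pos h0]
  have hsum : Summable fun k : ℕ => ‖f k * (k * r ^ (k - 1))‖ := by
    rw [← summable_nat_add_iff 1]
    refine (hf.shiftDeriv.summable_norm hr).congr fun k => ?_
    simp only [SymmetricGrothendieck.shiftDeriv]
    congr 1
    rw [Nat.add_sub_cancel]
    push_cast
    ring
  have key := hasDerivAt_tsum_of_isPreconnected (g := fun k y => f k * y ^ k)
    (g' := fun k y => f k * (k * y ^ (k - 1))) (t := Metric.ball 0 r) (y₀ := 0) (y := t)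
    hsum Metric.isOpen_ball (convex_ball 0 r).isPreconnected
    (fun k y _ => (hasDerivAt_pow k y).const_mul _) (fun k y hy => ?_) (by simpa using h0)
    (hf.summable (by simp)) (by simpa using h2)
  · convert! key using 1
    have hs : Summable fun k : ℕ => f k * (k * t ^ (k - 1)) := by
      rw [← summable_nat_add_iff 1]
      refine (hf.shiftDeriv.summable ht).congr fun k => ?_
      simp only [SymmetricGrothendieck.shiftDeriv]
      rw [Nat.add_sub_cancel]
      push_cast
      ring
    rw [hs.tsum_eq_zero_add]
    simp only [powSum, SymmetricGrothendieck.shiftDeriv]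
    simp
    exact tsum_congr fun k => by ring
  · have hy' : |y| ≤ r := by simpa using (Metric.mem_ball.1 hy).le
    simp only [norm_mul, norm_pow, Real.norm_eq_abs, abs_of_pos h0]
    gcongr

theorem Tame.mul_powSum_shiftDeriv {f : ℕ → ℝ} (hf : Tame f) {t : ℝ} (ht : |t| < 1) :
    HasSum (fun k : ℕ => k * f k * t ^ k)
      (t * powSum (SymmetricGrothendieck.shiftDeriv f) t) := by
  rw [← hasSum_nat_add_iff' 1]
  have := (hf.shiftDeriv.summable ht).hasSum.mul_left t
  simp only [SymmetricGrothendieck.shiftDeriv] at this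
  simp only [Finset.range_one, Finset.sum_singleton, Nat.cast_zero, zero_mul, sub_zero]
  convert! this using 1
  funext k
  push_cast
  ring

theorem eq_of_hasDerivAt_zero {g : ℝ → ℝ} (hg : ∀ t, |t| < 1 → HasDerivAt g 0 t) {t : ℝ}
    (ht : |t| < 1) : g t = g 0 := by
  have hball : ∀ t : ℝ, t ∈ Metric.ball (0 : ℝ) 1 ↔ |t| < 1 := fun t => by simp
  refine Metric.isOpen_ball.is_const_of_deriv_eq_zero (s := Metric.ball (0 : ℝ) 1)
    (convex_ball _ _).isPreconnected
    (fun t ht => (hg t ((hball t).1 ht)).differentiableAt.differentiableWithinAt)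
    (fun t ht => (hg t ((hball t).1 ht)).deriv) ((hball t).2 ht) (by simp)

end PowerSums

/-! ### The arcsine series on the closed interval -/

section Arcsin

/-- The normalised central binomial coefficients `C(2k, k) / 4 ^ k`. -/
noncomputable def wallisCoeff (k : ℕ) : ℝ := ∏ i ∈ Finset.range k, (2 * (i : ℝ) + 1) / (2 * i + 2)

theorem wallisCoeff_zero : wallisCoeff 0 = 1 := by simp [wallisCoeff]

theorem wallisCoeff_succ (k : ℕ) :
    wallisCoeff (k + 1) = wallisCoeff k * ((2 * k + 1) / (2 * k + 2)) := by
  rw [wallisCoeff, Finset.prod_range_succ, ← wallisCoeff]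

theorem wallisCoeff_pos (k : ℕ) : 0 < wallisCoeff k :=
  Finset.prod_pos fun i _ => by positivity

theorem wallisCoeff_le_one (k : ℕ) : wallisCoeff k ≤ 1 :=
  Finset.prod_le_one (fun i _ => by positivity) fun i _ =>
    (div_le_one (by positivity)).2 (by linarith)

theorem tame_wallisCoeff : Tame wallisCoeff :=
  tame_of_abs_le (C := 1) fun k => by
    rw [abs_of_pos (wallisCoeff_pos k)]
    exact wallisCoeff_le_one k

/-- The coefficient recursion is the equation (1 - t) f' = f / 2, which makes f(t) √(1 - t)
constant. -/
theorem powSum_wallisCoeff {t : ℝ} (ht : |t| < 1) : powSum wallisCoeff t = 1 / √(1 - t) := by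
  have hpos : ∀ {t : ℝ}, |t| < 1 → 0 < 1 - t := fun h => by linarith [(abs_lt.1 h).2]
  have hODE : ∀ {t : ℝ}, |t| < 1 →
      (1 - t) * powSum (shiftDeriv wallisCoeff) t = powSum wallisCoeff t / 2 := fun {t} ht => by
    have h1 := (tame_wallisCoeff.shiftDeriv.summable ht).hasSum
    have h2 := tame_wallisCoeff.mul_powSum_shiftDeriv ht
    have h3 := (tame_wallisCoeff.summable ht).hasSum.div_const 2
    have h4 := h1.sub h2
    have : (fun k : ℕ => shiftDeriv wallisCoeff k * t ^ k - k * wallisCoeff k * t ^ k) =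
        fun k => wallisCoeff k * t ^ k / 2 := by
      funext k
      simp only [shiftDeriv, wallisCoeff_succ]
      field_simp
      ring
    rw [this] at h4
    have := h4.unique h3
    simp only [powSum] at this ⊢
    linarith
  have hconst := eq_of_hasDerivAt_zero (g := fun t => powSum wallisCoeff t * √(1 - t))
    (fun t ht => by
      have h1 := tame_wallisCoeff.hasDerivAt ht
      have h2 : HasDerivAt (fun t : ℝ => √(1 - t)) (-1 / (2 * √(1 - t))) t :=
        ((hasDerivAt_id t).const_sub 1).sqrt (hpos ht).ne'
      convert! h1.mul h2 using 1
      have hs : 0 < √(1 - t) := Real.sqrt_pos.2 (hpos ht)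
      have hsq : √(1 - t) ^ 2 = 1 - t := Real.sq_sqrt (hpos ht).le
      have := hODE ht
      field_simp
      rw [hsq]
      linarith) ht
  simp only [powSum_zero, wallisCoeff_zero, sub_zero, Real.sqrt_one, mul_one] at hconst
  exact eq_one_div_of_mul_eq_one_left hconst

/-- The coefficients of the power series of `arcsin`. -/
noncomputable def arcsinCoeff (k : ℕ) : ℝ := wallisCoeff k / (2 * k + 1)

theorem arcsinCoeff_pos (k : ℕ) : 0 < arcsinCoeff k := by
  have := wallisCoeff_pos k
  unfold arcsinCoeff
  positivity

theorem tame_arcsinCoeff : Tame arcsinCoeff :=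
  tame_of_abs_le (C := 1) fun k => by
    rw [abs_of_pos (arcsinCoeff_pos k)]
    exact (div_le_self (wallisCoeff_pos k).le (by linarith [(Nat.cast_nonneg k : (0 : ℝ) ≤ k)])).trans
      (wallisCoeff_le_one k)

/-- Since (2k + 1) `arcsinCoeff k` = `wallisCoeff k`, the series differentiates to 1 / √(1 - x²),
the derivative of arcsin. -/
theorem hasSum_arcsin_of_abs_lt_one {x : ℝ} (hx : |x| < 1) :
    HasSum (fun k => arcsinCoeff k * x ^ (2 * k + 1)) (Real.arcsin x) := by
  have hsq : ∀ {x : ℝ}, |x| < 1 → |x ^ 2| < 1 := fun {x} h => by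
    rw [abs_pow]
    exact pow_lt_one₀ (abs_nonneg _) h two_ne_zero
  have hconst := eq_of_hasDerivAt_zero
    (g := fun x => x * powSum arcsinCoeff (x ^ 2) - Real.arcsin x) (fun x hx => by
      have h1 := HasDerivAt.comp (h := fun x : ℝ => x ^ 2) x
        (tame_arcsinCoeff.hasDerivAt (hsq hx)) (hasDerivAt_pow 2 x)
      have h2 := Real.hasDerivAt_arcsin (x := x) (by linarith [(abs_lt.1 hx).1])
        (by linarith [(abs_lt.1 hx).2])
      convert! ((hasDerivAt_id x).mul h1).sub h2 using 1
      rw [← powSum_wallisCoeff (hsq hx)]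
      have h3 := (tame_arcsinCoeff.summable (hsq hx)).hasSum
      have h4 := (tame_arcsinCoeff.mul_powSum_shiftDeriv (hsq hx)).mul_left 2
      have h5 := (tame_wallisCoeff.summable (hsq hx)).hasSum
      have : (fun k : ℕ => arcsinCoeff k * (x ^ 2) ^ k + 2 * (k * arcsinCoeff k * (x ^ 2) ^ k)) =
          fun k => wallisCoeff k * (x ^ 2) ^ k := by
        funext k
        simp only [arcsinCoeff]
        field_simp
        ring
      have h6 := h3.add h4
      rw [this] at h6
      have := h6.unique h5
      simp only [powSum, Function.comp, id] at this ⊢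
      rw [← this]
      push_cast
      ring) hx
  have : x * powSum arcsinCoeff (x ^ 2) = Real.arcsin x := by
    simp at hconst
    linarith
  rw [← this]
  convert! (tame_arcsinCoeff.summable (hsq hx)).hasSum.mul_left x using 1
  funext k
  ring

/-- The coefficients are positive, so partial sums at x in (0, 1) are at most arcsin x ≤ π/2; then x
tends to 1. -/
theorem summable_arcsinCoeff : Summable arcsinCoeff := by
  refine summable_of_sum_range_le (c := π / 2) (fun k => (arcsinCoeff_pos k).le) fun N => ?_
  have hlim : Tendsto (fun x : ℝ => ∑ k ∈ Finset.range N, arcsinCoeff k * x ^ (2 * k + 1))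
      (𝓝[<] 1) (𝓝 (∑ k ∈ Finset.range N, arcsinCoeff k * 1 ^ (2 * k + 1))) :=
    (Continuous.tendsto (by fun_prop) 1).mono_left nhdsWithin_le_nhds
  simp only [one_pow, mul_one] at hlim
  refine le_of_tendsto hlim ?_
  filter_upwards [Ioo_mem_nhdsLT (zero_lt_one' ℝ)] with x hx
  refine (sum_le_hasSum _ (fun k _ => ?_)
    (hasSum_arcsin_of_abs_lt_one (abs_lt.2 ⟨by linarith [hx.1], hx.2⟩))).trans
    (Real.arcsin_le_pi_div_two x)
  have := (arcsinCoeff_pos k).le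
  have := hx.1.le
  positivity

theorem norm_arcsinCoeff_mul_pow_le {x : ℝ} (hx : |x| ≤ 1) (k m : ℕ) :
    ‖arcsinCoeff k * x ^ m‖ ≤ arcsinCoeff k := by
  rw [norm_mul, norm_pow, Real.norm_eq_abs, Real.norm_eq_abs, abs_of_pos (arcsinCoeff_pos k)]
  exact mul_le_of_le_one_right (arcsinCoeff_pos k).le (pow_le_one₀ (abs_nonneg _) hx)

/-- The power series of `arcsin` on the closed interval `[-1, 1]`. -/
theorem hasSum_arcsin {x : ℝ} (hx : |x| ≤ 1) :
    HasSum (fun k => arcsinCoeff k * x ^ (2 * k + 1)) (Real.arcsin x) := by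
  have hsum : ∀ {x : ℝ}, |x| ≤ 1 → Summable fun k => arcsinCoeff k * x ^ (2 * k + 1) :=
    fun hx => summable_arcsinCoeff.of_norm_bounded fun k => norm_arcsinCoeff_mul_pow_le hx k _
  have hcont : ContinuousOn (fun x : ℝ => ∑' k, arcsinCoeff k * x ^ (2 * k + 1))
      (Set.Icc (-1) 1) :=
    continuousOn_tsum (fun k => by fun_prop) summable_arcsinCoeff
      fun k x hx => norm_arcsinCoeff_mul_pow_le (abs_le.2 hx) k _
  have heq : Set.EqOn (fun x : ℝ => ∑' k, arcsinCoeff k * x ^ (2 * k + 1)) Real.arcsin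
      (Set.Icc (-1) 1) := by
    refine Set.EqOn.of_subset_closure (s := Set.Ioo (-1) 1)
      (fun x hx => (hasSum_arcsin_of_abs_lt_one (abs_lt.2 hx)).tsum_eq) hcont
      Real.continuous_arcsin.continuousOn Set.Ioo_subset_Icc_self ?_
    rw [closure_Ioo (by norm_num)]
  have := heq (abs_le.1 hx)
  simp only at this
  rw [← this]
  exact (hsum hx).hasSum

end Arcsin

end SymmetricGrothendieck

namespace SymmetricGrothendieck

open MeasureTheory Filter Topology ProbabilityTheory
open scoped ComplexConjugate Real

/-! ### Phases as averages of signs, and the first Fourier coefficient of arcsin -/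

section Phase

/-- The phase of a complex number, with value `1` at `0`. -/
noncomputable def phase (w : ℂ) : ℂ := if w = 0 then 1 else w / ‖w‖

theorem norm_phase (w : ℂ) : ‖phase w‖ = 1 := by
  unfold phase
  split_ifs with h
  · simp
  · simp [h]

@[fun_prop]
theorem measurable_phase : Measurable phase :=
  Measurable.ite (measurableSet_singleton 0) measurable_const (by fun_prop)

theorem phase_of_ne_zero {w : ℂ} (hw : w ≠ 0) : phase w = Complex.exp (w.arg * Complex.I) := by
  rw [phase, if_neg hw, div_eq_iff (by simpa using hw), mul_comm, Complex.norm_mul_exp_arg_mul_I]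

theorem conj_exp_ofReal_mul_I (θ : ℝ) :
    conj (Complex.exp (θ * Complex.I)) = Complex.exp (-θ * Complex.I) := by
  rw [← Complex.exp_conj]
  simp

theorem periodic_exp_ofReal_mul_I :
    Function.Periodic (fun θ : ℝ => Complex.exp (θ * Complex.I)) (2 * π) := fun θ => by
  have := Complex.exp_periodic (θ * Complex.I)
  simp only
  rw [← this]
  push_cast
  ring_nf

theorem intervalIntegrable_of_norm_le {f : ℝ → ℂ} (hf : Measurable f) {C : ℝ}
    (h : ∀ t, ‖f t‖ ≤ C) (a b : ℝ) : IntervalIntegrable f volume a b := by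
  rw [intervalIntegrable_iff]
  have : IsFiniteMeasure (volume.restrict (Set.uIoc a b)) := by
    unfold Set.uIoc
    infer_instance
  exact Integrable.of_bound hf.aestronglyMeasurable C (ae_of_all _ h)

theorem integral_halfSign_cos_mul_exp :
    ∫ θ in (-(π / 2))..(3 * π / 2), (halfSign (Real.cos θ) : ℂ) * Complex.exp (θ * Complex.I) =
      4 := by
  have hpi := Real.pi_pos
  have hi := intervalIntegrable_of_norm_le
    (f := fun θ : ℝ => (halfSign (Real.cos θ) : ℂ) * Complex.exp (θ * Complex.I))
    (by fun_prop) (C := 1) (fun t => by simp [abs_halfSign, Complex.norm_exp_ofReal_mul_I])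
  have hint : ∀ a b : ℝ, ∫ θ in a..b, Complex.exp (θ * Complex.I) =
      (Complex.exp (b * Complex.I) - Complex.exp (a * Complex.I)) / Complex.I := fun a b => by
    have := integral_exp_mul_complex (a := a) (b := b) Complex.I_ne_zero
    simpa only [mul_comm Complex.I] using this
  have h1 : Complex.exp ((π / 2 : ℝ) * Complex.I) = Complex.I := by
    push_cast
    exact Complex.exp_pi_div_two_mul_I
  have h2 : Complex.exp ((-(π / 2) : ℝ) * Complex.I) = -Complex.I := by
    push_cast
    rw [← neg_div]
    exact Complex.exp_neg_pi_div_two_mul_I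
  have h3 : Complex.exp ((3 * π / 2 : ℝ) * Complex.I) = -Complex.I := by
    have := periodic_exp_ofReal_mul_I (-(π / 2))
    simp only at this
    rw [← h2, ← this]
    congr 3
    ring
  have hA : ∫ θ in (-(π / 2))..(π / 2), (halfSign (Real.cos θ) : ℂ) *
      Complex.exp (θ * Complex.I) = ∫ θ in (-(π / 2))..(π / 2), Complex.exp (θ * Complex.I) := by
    rw [intervalIntegral.integral_of_le (by linarith), intervalIntegral.integral_of_le (by linarith),
      integral_Ioc_eq_integral_Ioo, integral_Ioc_eq_integral_Ioo]
    refine setIntegral_congr_fun measurableSet_Ioo fun θ hθ => ?_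
    simp [halfSign_of_nonneg (Real.cos_pos_of_mem_Ioo hθ).le]
  have hB : ∫ θ in (π / 2)..(3 * π / 2), (halfSign (Real.cos θ) : ℂ) *
      Complex.exp (θ * Complex.I) = ∫ θ in (π / 2)..(3 * π / 2), -Complex.exp (θ * Complex.I) := by
    rw [intervalIntegral.integral_of_le (by linarith), intervalIntegral.integral_of_le (by linarith),
      integral_Ioc_eq_integral_Ioo, integral_Ioc_eq_integral_Ioo]
    refine setIntegral_congr_fun measurableSet_Ioo fun θ hθ => ?_
    simp [halfSign_of_neg (Real.cos_neg_of_pi_div_two_lt_of_lt hθ.1 (by linarith [hθ.2]))]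
  rw [← intervalIntegral.integral_add_adjacent_intervals (hi _ (π / 2)) (hi _ _), hA, hB,
    intervalIntegral.integral_neg, hint, hint, h1, h2, h3]
  field_simp
  ring

/-- The phase is an average of real signs. -/
theorem integral_halfSign_mul_exp {w : ℂ} (hw : w ≠ 0) :
    ∫ θ in (0 : ℝ)..(2 * π), (halfSign (Complex.exp (-θ * Complex.I) * w).re : ℂ) *
      Complex.exp (θ * Complex.I) = 4 * phase w := by
  have hw' : 0 < ‖w‖ := norm_pos_iff.2 hw
  set f : ℝ → ℂ := fun θ => (halfSign (Real.cos θ) : ℂ) * Complex.exp (θ * Complex.I) with hf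
  have key : ∀ θ : ℝ, (halfSign (Complex.exp (-θ * Complex.I) * w).re : ℂ) *
      Complex.exp (θ * Complex.I) = f (θ - w.arg) * phase w := fun θ => by
    have h1 : Complex.exp (-θ * Complex.I) * w =
        ‖w‖ * Complex.exp (((-(θ - w.arg) : ℝ) : ℂ) * Complex.I) := by
      conv_lhs => rw [← Complex.norm_mul_exp_arg_mul_I w]
      rw [mul_left_comm, ← Complex.exp_add]
      congr 2
      push_cast
      ring
    rw [h1, Complex.re_ofReal_mul, Complex.exp_ofReal_mul_I_re, halfSign_mul_of_pos hw',
      Real.cos_neg, phase_of_ne_zero hw, hf]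
    simp only
    rw [mul_assoc, ← Complex.exp_add]
    congr 2
    push_cast
    ring
  simp only [key]
  rw [intervalIntegral.integral_mul_const, intervalIntegral.integral_comp_sub_right f]
  have hper : Function.Periodic f (2 * π) := fun θ => by
    have := periodic_exp_ofReal_mul_I θ
    simp only [hf, Real.cos_add_two_pi] at this ⊢
    rw [this]
  have := hper.intervalIntegral_add_eq (0 - w.arg) (-(π / 2))
  rw [← integral_halfSign_cos_mul_exp, show (2 * π - w.arg) = 0 - w.arg + 2 * π by ring, this]
  congr 2
  ring

/-- The first Fourier coefficient of `θ ↦ arcsin (Re (e^{-iθ} z))`, up to normalisation. -/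
noncomputable def arcsinFourier (z : ℂ) : ℂ :=
  ∫ θ in (0 : ℝ)..(2 * π), (Real.arcsin (Complex.exp (-θ * Complex.I) * z).re : ℂ) *
    Complex.exp (θ * Complex.I)

/-- A rotation of z is a translation of θ over a full period. This equivariance reduces the
computation to real z. -/
theorem arcsinFourier_exp_mul (φ : ℝ) (z : ℂ) :
    arcsinFourier (Complex.exp (φ * Complex.I) * z) =
      Complex.exp (φ * Complex.I) * arcsinFourier z := by
  set f : ℝ → ℂ := fun θ => (Real.arcsin (Complex.exp (-θ * Complex.I) * z).re : ℂ) *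
    Complex.exp (θ * Complex.I) with hf
  have key : ∀ θ : ℝ, (Real.arcsin (Complex.exp (-θ * Complex.I) *
      (Complex.exp (φ * Complex.I) * z)).re : ℂ) * Complex.exp (θ * Complex.I) =
      Complex.exp (φ * Complex.I) * f (θ - φ) := fun θ => by
    have h1 : Complex.exp (-θ * Complex.I) * (Complex.exp (φ * Complex.I) * z) =
        Complex.exp (-((θ - φ : ℝ) : ℂ) * Complex.I) * z := by
      rw [← mul_assoc, ← Complex.exp_add]
      congr 2
      push_cast
      ring
    simp only [hf]
    rw [h1, mul_left_comm, ← Complex.exp_add]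
    congr 2
    push_cast
    ring
  have hper : Function.Periodic f (2 * π) := fun θ => by
    have h1 := periodic_exp_ofReal_mul_I θ
    have h2 : Complex.exp (-((θ + 2 * π : ℝ) : ℂ) * Complex.I) =
        Complex.exp (-(θ : ℂ) * Complex.I) := by
      rw [← conj_exp_ofReal_mul_I, ← conj_exp_ofReal_mul_I]
      simp only at h1
      rw [h1]
    simp only [hf] at h1 ⊢
    rw [h2, h1]
  unfold arcsinFourier
  simp only [key]
  rw [intervalIntegral.integral_const_mul, intervalIntegral.integral_comp_sub_right f,
    show (2 * π - φ) = 0 - φ + 2 * π by ring, hper.intervalIntegral_add_eq (0 - φ) 0, zero_add]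

theorem integral_cos_pow_even (m : ℕ) :
    ∫ θ in (0 : ℝ)..(2 * π), Real.cos θ ^ (2 * m) = 2 * π * wallisCoeff m := by
  induction m with
  | zero => simp [wallisCoeff_zero]
  | succ m ih =>
    rw [mul_add, mul_one, integral_cos_pow, ih, wallisCoeff_succ]
    simp
    ring

/-- The sine part of exp(iθ) integrates to zero; the cosine part raises the power to the even
exponent 2(k + 1). -/
theorem integral_cos_pow_odd_mul_exp (k : ℕ) :
    ∫ θ in (0 : ℝ)..(2 * π), (Real.cos θ : ℂ) ^ (2 * k + 1) * Complex.exp (θ * Complex.I) =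
      2 * π * wallisCoeff (k + 1) := by
  have h1 : ∀ θ : ℝ, (Real.cos θ : ℂ) ^ (2 * k + 1) * Complex.exp (θ * Complex.I) =
      ((Real.cos θ ^ (2 * (k + 1)) : ℝ) : ℂ) +
        ((Real.sin θ ^ (2 * 0 + 1) * Real.cos θ ^ (2 * k + 1) : ℝ) : ℂ) * Complex.I := fun θ => by
    rw [Complex.exp_mul_I]
    push_cast
    ring
  simp only [h1]
  rw [intervalIntegral.integral_add (by apply Continuous.intervalIntegrable; fun_prop)
    (by apply Continuous.intervalIntegrable; fun_prop), intervalIntegral.integral_mul_const,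
    intervalIntegral.integral_ofReal, intervalIntegral.integral_ofReal, integral_cos_pow_even,
    integral_sin_pow_odd_mul_cos_pow]
  simp

theorem hasSum_arcsinFourier_ofReal {ρ : ℝ} (hρ : |ρ| ≤ 1) :
    HasSum (fun k => ((arcsinCoeff k * ρ ^ (2 * k + 1) * (2 * π * wallisCoeff (k + 1)) : ℝ) : ℂ))
      (arcsinFourier ρ) := by
  have hre : ∀ θ : ℝ, (Complex.exp (-θ * Complex.I) * ρ).re = ρ * Real.cos θ := fun θ => by
    rw [mul_comm, Complex.re_ofReal_mul, ← Complex.ofReal_neg, Complex.exp_ofReal_mul_I_re,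
      Real.cos_neg]
  have hle : ∀ θ : ℝ, |ρ * Real.cos θ| ≤ 1 := fun θ => by
    rw [abs_mul]
    exact mul_le_one₀ hρ (abs_nonneg _) (Real.abs_cos_le_one θ)
  have key := intervalIntegral.hasSum_integral_of_dominated_convergence (a := 0) (b := 2 * π)
    (μ := volume) (bound := fun k _ => arcsinCoeff k)
    (F := fun (k : ℕ) (θ : ℝ) => ((arcsinCoeff k * (ρ * Real.cos θ) ^ (2 * k + 1) : ℝ) : ℂ) *
      Complex.exp (θ * Complex.I))
    (f := fun θ => (Real.arcsin (Complex.exp (-θ * Complex.I) * ρ).re : ℂ) *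
      Complex.exp (θ * Complex.I))
    (fun k => Continuous.aestronglyMeasurable (by fun_prop))
    (fun k => ae_of_all _ fun θ _ => by
      rw [norm_mul, Complex.norm_exp_ofReal_mul_I, mul_one, Complex.norm_real]
      exact norm_arcsinCoeff_mul_pow_le (hle θ) k _)
    (ae_of_all _ fun θ _ => summable_arcsinCoeff)
    (by simp)
    (ae_of_all _ fun θ _ => by
      rw [hre]
      exact (Complex.hasSum_ofReal.2 (hasSum_arcsin (hle θ))).mul_right _)
  unfold arcsinFourier
  convert! key using 1
  funext k
  have : ∀ θ : ℝ, ((arcsinCoeff k * (ρ * Real.cos θ) ^ (2 * k + 1) : ℝ) : ℂ) *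
      Complex.exp (θ * Complex.I) = ((arcsinCoeff k * ρ ^ (2 * k + 1) : ℝ) : ℂ) *
        ((Real.cos θ : ℂ) ^ (2 * k + 1) * Complex.exp (θ * Complex.I)) := fun θ => by
    push_cast
    rw [mul_pow]
    ring
  simp only [this]
  rw [intervalIntegral.integral_const_mul, integral_cos_pow_odd_mul_exp]
  push_cast
  ring

/-- The Taylor coefficients of the hypergeometric function `₂F₁(1/2, 1/2; 2; ·)`. -/
noncomputable def haagerupCoeff (k : ℕ) : ℝ := wallisCoeff k ^ 2 / (k + 1)

/-- The factors 2k + 1 cancel, which is what turns the arcsine series into a hypergeometric one. -/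
theorem arcsinCoeff_mul_wallisCoeff (k : ℕ) :
    arcsinCoeff k * wallisCoeff (k + 1) = haagerupCoeff k / 2 := by
  rw [wallisCoeff_succ, arcsinCoeff, haagerupCoeff]
  field_simp

theorem haagerupCoeff_pos (k : ℕ) : 0 < haagerupCoeff k := by
  have := wallisCoeff_pos k
  unfold haagerupCoeff
  positivity

theorem summable_haagerupCoeff : Summable haagerupCoeff := by
  refine Summable.of_nonneg_of_le (fun k => (haagerupCoeff_pos k).le) (fun k => ?_)
    (summable_arcsinCoeff.mul_left 2)
  have := arcsinCoeff_mul_wallisCoeff k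
  nlinarith [arcsinCoeff_pos k, wallisCoeff_le_one (k + 1)]

theorem summable_haagerupCoeff_mul_pow {t : ℝ} (ht : |t| ≤ 1) :
    Summable fun k => haagerupCoeff k * t ^ k :=
  summable_haagerupCoeff.of_norm_bounded fun k => by
    rw [norm_mul, norm_pow, Real.norm_eq_abs, Real.norm_eq_abs, abs_of_pos (haagerupCoeff_pos k)]
    exact mul_le_of_le_one_right (haagerupCoeff_pos k).le (pow_le_one₀ (abs_nonneg _) ht)

theorem arcsinFourier_eq {z : ℂ} (hz : ‖z‖ ≤ 1) :
    arcsinFourier z = π * z * powSum haagerupCoeff (‖z‖ ^ 2) := by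
  have hz2 : |‖z‖ ^ 2| ≤ 1 := by
    rw [abs_of_nonneg (by positivity)]
    exact pow_le_one₀ (norm_nonneg _) hz
  have h1 := hasSum_arcsinFourier_ofReal (ρ := ‖z‖) (by simpa using hz)
  have h2 := (Complex.hasSum_ofReal.2 (summable_haagerupCoeff_mul_pow hz2).hasSum).mul_left
    (π * ‖z‖ : ℂ)
  have h3 : arcsinFourier ‖z‖ = π * ‖z‖ * powSum haagerupCoeff (‖z‖ ^ 2) := by
    refine h1.unique ?_
    convert! h2 using 1
    funext k
    have := arcsinCoeff_mul_wallisCoeff k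
    rw [show arcsinCoeff k * ‖z‖ ^ (2 * k + 1) * (2 * π * wallisCoeff (k + 1)) =
      2 * π * ‖z‖ ^ (2 * k + 1) * (arcsinCoeff k * wallisCoeff (k + 1)) by ring, this]
    push_cast
    ring
  conv_lhs => rw [← Complex.norm_mul_exp_arg_mul_I z]
  rw [mul_comm (‖z‖ : ℂ), arcsinFourier_exp_mul, h3]
  linear_combination (π * powSum haagerupCoeff (‖z‖ ^ 2) : ℂ) * Complex.norm_mul_exp_arg_mul_I z

end Phase

/-! ### Haagerup's identity for complex Gaussian phases -/

section ComplexGaussian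

variable {d : ℕ}

theorem real_inner_eq_re (x y : EuclideanSpace ℂ (Fin d)) : inner ℝ x y = (inner ℂ x y).re := by
  simp [PiLp.inner_apply, Complex.inner]

theorem real_inner_exp_smul (θ : ℝ) (x g : EuclideanSpace ℂ (Fin d)) :
    inner ℝ (Complex.exp (-θ * Complex.I) • x) g =
      (Complex.exp (-θ * Complex.I) * inner ℂ g x).re := by
  rw [real_inner_comm, real_inner_eq_re, inner_smul_right]

theorem norm_exp_smul (θ : ℝ) (x : EuclideanSpace ℂ (Fin d)) : ‖Complex.exp (-θ * Complex.I) • x‖ = ‖x‖ := by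
  rw [norm_smul, ← Complex.ofReal_neg, Complex.norm_exp_ofReal_mul_I, one_mul]

theorem stdGaussian_complex_inner_ne_zero {x : EuclideanSpace ℂ (Fin d)} (hx : ‖x‖ = 1) :
    ∀ᵐ g ∂(stdGaussian (EuclideanSpace ℂ (Fin d))), inner ℂ g x ≠ 0 := by
  filter_upwards [stdGaussian_inner_eq_zero hx] with g hg h0
  rw [real_inner_comm, real_inner_eq_re, h0] at hg
  simp at hg

/-- Correlating a bounded function with a phase reduces to correlating it with signs. -/
theorem integral_mul_phase {f : EuclideanSpace ℂ (Fin d) → ℂ} (hf : Measurable f)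
    (hf1 : ∀ g, ‖f g‖ ≤ 1) {x : EuclideanSpace ℂ (Fin d)}
    (hx : ‖x‖ = 1) :
    4 * ∫ g, f g * phase (inner ℂ g x) ∂(stdGaussian (EuclideanSpace ℂ (Fin d))) =
      ∫ θ in (0 : ℝ)..(2 * π), (∫ g, f g *
        (halfSign (inner ℝ (Complex.exp (-θ * Complex.I) • x) g) : ℂ) ∂(stdGaussian (EuclideanSpace ℂ (Fin d)))) *
          Complex.exp (θ * Complex.I) := by
  have : IsFiniteMeasure (volume.restrict (Set.uIoc 0 (2 * π))) := by
    unfold Set.uIoc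
    infer_instance
  simp only [real_inner_exp_smul, ← integral_mul_const]
  rw [intervalIntegral_integral_swap, ← integral_const_mul]
  · refine integral_congr_ae ?_
    filter_upwards [stdGaussian_complex_inner_ne_zero hx] with g hg
    rw [mul_left_comm, ← integral_halfSign_mul_exp hg, ← intervalIntegral.integral_const_mul]
    exact intervalIntegral.integral_congr fun θ _ => by ring
  · refine Integrable.of_bound (Measurable.aestronglyMeasurable ?_) 1 (ae_of_all _ fun p => ?_)
    · fun_prop
    · simpa [Function.uncurry, Complex.norm_exp_ofReal_mul_I, abs_halfSign] using hf1 p.2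

/-- Replacing the phase by an average of signs leaves sign correlations, which Grothendieck's
identity evaluates as arcsines of rotated inner products. -/
theorem integral_halfSign_mul_phase {x y : EuclideanSpace ℂ (Fin d)} (hx : ‖x‖ = 1) (hy : ‖y‖ = 1) :
    ∫ g, (halfSign (inner ℝ y g) : ℂ) * phase (inner ℂ g x) ∂(stdGaussian (EuclideanSpace ℂ (Fin d))) =
      1 / (2 * π) * arcsinFourier (inner ℂ y x) := by
  have hpi : (π : ℂ) ≠ 0 := by simp [Real.pi_ne_zero]
  have h := integral_mul_phase (f := fun g : EuclideanSpace ℂ (Fin d) => (halfSign (inner ℝ y g) : ℂ)) (by fun_prop)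
    (fun g => by simp [abs_halfSign]) hx
  have h2 : ∀ θ : ℝ, ∫ g, (halfSign (inner ℝ y g) : ℂ) *
      (halfSign (inner ℝ (Complex.exp (-θ * Complex.I) • x) g) : ℂ) ∂(stdGaussian (EuclideanSpace ℂ (Fin d))) =
      2 / π * (Real.arcsin (Complex.exp (-θ * Complex.I) * inner ℂ y x).re : ℂ) := fun θ => by
    have := integral_halfSign_inner_mul hy ((norm_exp_smul θ x).trans hx)
    rw [real_inner_comm, real_inner_exp_smul] at this
    have h3 := congrArg (fun r : ℝ => (r : ℂ)) this
    simp only [← integral_complex_ofReal] at h3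
    push_cast at h3
    exact h3
  simp_rw [h2, mul_assoc (2 / π : ℂ)] at h
  rw [intervalIntegral.integral_const_mul] at h
  change _ = 2 / π * arcsinFourier (inner ℂ y x) at h
  field_simp at h ⊢
  linear_combination h / 2

/-- **Haagerup's identity** for the correlation of complex phases. -/
theorem integral_conj_phase_mul_phase {x y : EuclideanSpace ℂ (Fin d)} (hx : ‖x‖ = 1) (hy : ‖y‖ = 1) :
    ∫ g, conj (phase (inner ℂ g x)) * phase (inner ℂ g y) ∂(stdGaussian (EuclideanSpace ℂ (Fin d))) =
      π / 4 * inner ℂ x y * powSum haagerupCoeff (‖(inner ℂ x y : ℂ)‖ ^ 2) := by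
  have hpi : (π : ℂ) ≠ 0 := by simp [Real.pi_ne_zero]
  have hz : ‖(inner ℂ x y : ℂ)‖ ≤ 1 := by simpa [hx, hy] using norm_inner_le_norm (𝕜 := ℂ) x y
  have h := integral_mul_phase (f := fun g : EuclideanSpace ℂ (Fin d) => conj (phase (inner ℂ g y)))
    (by fun_prop) (fun g => by simp [norm_phase]) hx
  -- By equivariance, rotating x produces a factor that cancels exp(iθ), so the integrand is
  -- constant in θ.
  have h2 : ∀ θ : ℝ, (∫ g, conj (phase (inner ℂ g y)) *
      (halfSign (inner ℝ (Complex.exp (-θ * Complex.I) • x) g) : ℂ) ∂(stdGaussian (EuclideanSpace ℂ (Fin d)))) *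
        Complex.exp (θ * Complex.I) = conj (1 / (2 * π) * arcsinFourier (inner ℂ x y)) := fun θ => by
    have h3 := congrArg conj (integral_halfSign_mul_phase hy ((norm_exp_smul θ x).trans hx))
    rw [← integral_conj, inner_smul_left, ← conj_exp_ofReal_mul_I, Complex.conj_conj,
      arcsinFourier_exp_mul] at h3
    simp only [map_mul, Complex.conj_ofReal] at h3
    simp_rw [← conj_exp_ofReal_mul_I, mul_comm (conj (phase _))]
    rw [h3]
    have h4 : conj (Complex.exp (θ * Complex.I)) * Complex.exp (θ * Complex.I) = 1 := by
      rw [conj_exp_ofReal_mul_I, ← Complex.exp_add]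
      simp
    simp only [map_mul]
    linear_combination (conj (1 / (2 * π) : ℂ) * conj (arcsinFourier (inner ℂ x y))) * h4
  simp only [h2] at h
  rw [intervalIntegral.integral_const] at h
  have h5 := congrArg conj h
  simp only [map_mul, ← integral_conj, Complex.conj_conj, arcsinFourier_eq hz, sub_zero,
    Complex.real_smul, Complex.conj_ofReal] at h5
  simp only [mul_comm (conj _)]
  have h6 : conj (4 : ℂ) = 4 := by simpa using Complex.conj_ofReal 4
  rw [h6] at h5
  push_cast at h5
  field_simp at h5 ⊢
  linear_combination h5

/-- A phase has correlation 1 with itself, so the identity at x = y evaluates the series at 1. -/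
theorem powSum_haagerupCoeff_one : powSum haagerupCoeff 1 = 4 / π := by
  have hx : ‖(EuclideanSpace.single 0 1 : EuclideanSpace ℂ (Fin 1))‖ = 1 := by simp
  have h := integral_conj_phase_mul_phase hx hx
  have h1 : ∀ w : ℂ, conj (phase w) * phase w = 1 := fun w => by
    rw [mul_comm, Complex.mul_conj']
    simp [norm_phase]
  simp only [h1, inner_self_eq_norm_sq_to_K, hx] at h
  simp at h
  have h2 : 1 = π / 4 * powSum haagerupCoeff 1 := by exact_mod_cast h
  have := Real.pi_ne_zero
  field_simp at h2 ⊢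
  linarith

theorem isCut_phase {n : ℕ} {x : Fin n → EuclideanSpace ℂ (Fin d)} (hx : ∀ i, ‖x i‖ = 1) :
    IsCut (fun i j => (π / 4 : ℂ) * inner ℂ (x i) (x j) *
      powSum haagerupCoeff (‖(inner ℂ (x i) (x j) : ℂ)‖ ^ 2)) := by
  have := isCut_integral (𝕜 := ℂ) (stdGaussian (EuclideanSpace ℂ (Fin d))) (δ := fun i g => phase (inner ℂ g (x i)))
    (fun i g => norm_phase _) (fun i => Measurable.aestronglyMeasurable (by fun_prop))
  simpa only [integral_conj_phase_mul_phase (hx _) (hx _)] using this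

end ComplexGaussian

end SymmetricGrothendieck

namespace SymmetricGrothendieck

open MeasureTheory Filter Topology
open scoped Real

/-! ### Estimates for the Riccati recursion -/

section Riccati

/-- A decreasing convolution recursion: `(m + 2) y_m + (y * y)_{m-1} = 1 / 4`. -/
structure RiccatiSeq (y : ℕ → ℝ) : Prop where
  zero : y 0 = 1 / 8
  succ : ∀ m, (m + 3) * y (m + 1) + ∑ i ∈ Finset.range (m + 1), y i * y (m - i) = 1 / 4

variable {y : ℕ → ℝ}

/-- Equality holds at m = 3, which fixes 11/60; afterwards each new term is at most 1/6 < 11/60. -/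
theorem sum_range_inv_le (m : ℕ) :
    ∑ i ∈ Finset.range (m + 1), 1 / ((i : ℝ) + 2) ≤ 11 / 60 * (m + 4) := by
  have base : ∀ m : ℕ, ∑ i ∈ Finset.range (m + 3 + 1), 1 / ((i : ℝ) + 2) ≤
      11 / 60 * ((m + 3 : ℕ) + 4) := fun m => by
    induction m with
    | zero => norm_num [Finset.sum_range_succ]
    | succ m ih =>
      rw [Finset.sum_range_succ]
      have : 1 / (((m + 1 + 3 : ℕ) : ℝ) + 2) ≤ 1 / 6 := by
        push_cast
        exact one_div_le_one_div_of_le (by norm_num) (by linarith [(Nat.cast_nonneg m : (0 : ℝ) ≤ m)])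
      push_cast at ih this ⊢
      rw [show (m : ℝ) + 1 + 3 + 2 = m + 4 + 2 by ring] at this
      rw [show m + 3 + 1 = m + 4 from rfl] at ih
      linarith
  rcases lt_or_ge m 3 with h | h
  · interval_cases m <;> norm_num [Finset.sum_range_succ]
  · obtain ⟨k, rfl⟩ := Nat.exists_eq_add_of_le' h
    exact base k

/-- Partial fractions split 1/((i + 2)(m - i + 2)) with a factor 1/(m + 4), and the two halves have
equal sums. -/
theorem conv_le_of_le {m : ℕ} (h : ∀ i ≤ m, 0 ≤ y i ∧ y i ≤ 1 / (4 * (i + 2))) :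
    ∑ i ∈ Finset.range (m + 1), y i * y (m - i) ≤ 11 / 480 := by
  have h1 : ∀ i ∈ Finset.range (m + 1), y i * y (m - i) ≤
      1 / (16 * (m + 4)) * (1 / ((i : ℝ) + 2) + 1 / (((m - i : ℕ) : ℝ) + 2)) := fun i hi => by
    have hi' : i ≤ m := Nat.lt_succ_iff.1 (Finset.mem_range.1 hi)
    refine (mul_le_mul (h i hi').2 (h (m - i) (by omega)).2 (h (m - i) (by omega)).1
      (by positivity)).trans_eq ?_
    obtain ⟨j, rfl⟩ := Nat.exists_eq_add_of_le hi'
    rw [Nat.add_sub_cancel_left]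
    push_cast
    field_simp
    ring
  refine (Finset.sum_le_sum h1).trans ?_
  rw [← Finset.mul_sum, Finset.sum_add_distrib]
  have h2 : ∑ i ∈ Finset.range (m + 1), 1 / (((m - i : ℕ) : ℝ) + 2) =
      ∑ i ∈ Finset.range (m + 1), 1 / ((i : ℝ) + 2) := by
    rw [← Finset.sum_range_reflect (fun i : ℕ => 1 / ((i : ℝ) + 2))]
    refine Finset.sum_congr rfl fun i hi => ?_
    rw [show m + 1 - 1 - i = m - i by omega]
  rw [h2]
  have h3 := sum_range_inv_le m
  rw [div_mul_eq_mul_div, one_mul, div_le_iff₀ (by positivity)]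
  linarith

theorem RiccatiSeq.bounds (hy : RiccatiSeq y) (m : ℕ) : 0 ≤ y m ∧ y m ≤ 1 / (4 * (m + 2)) := by
  induction m using Nat.strong_induction_on with
  | _ m ih =>
    rcases m with _ | m
    · rw [hy.zero]
      norm_num
    · have ih' : ∀ i ≤ m, 0 ≤ y i ∧ y i ≤ 1 / (4 * ((i : ℝ) + 2)) :=
        fun i hi => ih i (Nat.lt_succ_of_le hi)
      have h1 := conv_le_of_le ih'
      have h2 : 0 ≤ ∑ i ∈ Finset.range (m + 1), y i * y (m - i) :=
        Finset.sum_nonneg fun i hi => mul_nonneg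
          (ih' i (Nat.lt_succ_iff.1 (Finset.mem_range.1 hi))).1 (ih' (m - i) (by omega)).1
      have h3 := hy.succ m
      have hm : (0 : ℝ) < m + 3 := by positivity
      constructor
      · by_contra! hneg
        nlinarith
      · rw [le_div_iff₀ (by positivity)]
        push_cast
        linarith

theorem RiccatiSeq.conv_le (hy : RiccatiSeq y) (m : ℕ) :
    ∑ i ∈ Finset.range (m + 1), y i * y (m - i) ≤ 11 / 480 :=
  conv_le_of_le fun i _ => hy.bounds i

theorem conv_succ_sub (y : ℕ → ℝ) (m : ℕ) :
    ∑ i ∈ Finset.range (m + 2), y i * y (m + 1 - i) - ∑ i ∈ Finset.range (m + 1), y i * y (m - i) =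
      y 0 * y (m + 1) - ∑ i ∈ Finset.range (m + 1), (y i - y (i + 1)) * y (m - i) := by
  rw [Finset.sum_range_succ' _ (m + 1)]
  simp only [sub_mul, Finset.sum_sub_distrib, Nat.add_sub_add_right, Nat.sub_zero]
  ring

/-- Every weight y (m - i) is at least y (m + 1), so the subtracted sum is at least (y 0 - y (m +
1)) y (m + 1) by telescoping. -/
theorem conv_succ_sub_le {m : ℕ} (hanti : ∀ i ≤ m, y (i + 1) ≤ y i) :
    ∑ i ∈ Finset.range (m + 2), y i * y (m + 1 - i) - ∑ i ∈ Finset.range (m + 1), y i * y (m - i) ≤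
      y (m + 1) ^ 2 := by
  rw [conv_succ_sub]
  have hmono : ∀ i ≤ m, y (m + 1) ≤ y (m - i) := fun i hi => by
    induction i with
    | zero => exact hanti m le_rfl
    | succ i ih =>
      refine (ih (by omega)).trans ?_
      have := hanti (m - (i + 1)) (by omega)
      rwa [show m - (i + 1) + 1 = m - i by omega] at this
  have h1 : ∑ i ∈ Finset.range (m + 1), (y i - y (i + 1)) * y (m + 1) ≤
      ∑ i ∈ Finset.range (m + 1), (y i - y (i + 1)) * y (m - i) :=
    Finset.sum_le_sum fun i hi => by
      have hi' : i ≤ m := Nat.lt_succ_iff.1 (Finset.mem_range.1 hi)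
      exact mul_le_mul_of_nonneg_left (hmono i hi') (sub_nonneg.2 (hanti i hi'))
  rw [← Finset.sum_mul, Finset.sum_range_sub'] at h1
  nlinarith

theorem sum_range_telescope_le (m : ℕ) :
    ∑ i ∈ Finset.range (m + 1), 1 / (((i : ℝ) + 2) * (i + 3)) ≤ 1 / 2 := by
  have h : ∀ i ∈ Finset.range (m + 1), 1 / (((i : ℝ) + 2) * (i + 3)) =
      1 / ((i : ℝ) + 2) - 1 / (((i + 1 : ℕ) : ℝ) + 2) := fun i _ => by
    push_cast
    field_simp
    ring
  rw [Finset.sum_congr rfl h, Finset.sum_range_sub' (fun i : ℕ => 1 / ((i : ℝ) + 2))]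
  have : (0 : ℝ) ≤ 1 / (((m + 1 : ℕ) : ℝ) + 2) := by positivity
  push_cast at this ⊢
  linarith

/-- The two claims are proved together: the bound on earlier decrements limits how fast the
convolution falls, which gives monotonicity, and monotonicity up to m + 1 gives the next decrement
bound. -/
theorem RiccatiSeq.antitone_and_sub_le (hy : RiccatiSeq y) (m : ℕ) :
    y (m + 1) ≤ y m ∧ (m + 3) * (y m - y (m + 1)) ≤ 9 / 8 * y m := by
  induction m using Nat.strong_induction_on with
  | _ m ih =>
    have hy1 : ∀ i, y i ≤ 1 / 8 := fun i => (hy.bounds i).2.trans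
      (one_div_le_one_div_of_le (by norm_num) (by linarith [(Nat.cast_nonneg i : (0 : ℝ) ≤ i)]))
    rcases m with _ | m
    · have h := hy.succ 0
      have h0 := hy.zero
      norm_num [h0] at h ⊢
      constructor <;> linarith
    · have hanti : ∀ i ≤ m, y (i + 1) ≤ y i := fun i hi => (ih i (Nat.lt_succ_of_le hi)).1
      have hrec := hy.succ m
      have hrec' := hy.succ (m + 1)
      have hconv := hy.conv_le m
      have hup := conv_succ_sub_le hanti
      have hsub := conv_succ_sub y m
      push_cast at hrec' ⊢
      set T := ∑ i ∈ Finset.range (m + 1), y i * y (m - i)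
      set T' := ∑ i ∈ Finset.range (m + 2), y i * y (m + 1 - i)
      have hlow : (m + 3) * ∑ i ∈ Finset.range (m + 1), (y i - y (i + 1)) * y (m - i) ≤
          9 / 128 := by
        have h1 : ∀ i ∈ Finset.range (m + 1), (m + 3) * ((y i - y (i + 1)) * y (m - i)) ≤
            9 / 128 * (1 / (((i : ℝ) + 2) * (i + 3)) + 1 / (2 * (m + 3))) := fun i hi => by
          have hi' : i ≤ m := Nat.lt_succ_iff.1 (Finset.mem_range.1 hi)
          have h2 : y i - y (i + 1) ≤ 9 / 32 / ((i + 2) * (i + 3)) := by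
            have h3 := (ih i (Nat.lt_succ_of_le hi')).2
            have h4 := (hy.bounds i).2
            rw [le_div_iff₀ (by positivity)] at h4 ⊢
            nlinarith [(by positivity : (0 : ℝ) < i + 2)]
          have h5 := mul_le_mul h2 (hy.bounds (m - i)).2 (hy.bounds (m - i)).1 (by positivity)
          refine (mul_le_mul_of_nonneg_left h5 (by positivity)).trans ?_
          obtain ⟨j, rfl⟩ := Nat.exists_eq_add_of_le hi'
          rw [Nat.add_sub_cancel_left]
          push_cast
          have e1 : ((i : ℝ) + j + 3) * (9 / 32 / ((i + 2) * (i + 3)) * (1 / (4 * (j + 2)))) =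
              9 / 128 * (1 / (((i : ℝ) + 2) * (i + 3)) * ((i + j + 3) / (j + 2))) := by
            field_simp
            ring
          rw [e1]
          gcongr
          have e2 : 1 / (((i : ℝ) + 2) * (i + 3)) * ((i + j + 3) / (j + 2)) =
              1 / (((i : ℝ) + 2) * (i + 3)) + (i + 1) / ((i + 2) * (i + 3) * (j + 2)) := by
            field_simp
            ring
          rw [e2]
          gcongr 1 / (((i : ℝ) + 2) * (i + 3)) + ?_
          rw [div_le_div_iff₀ (by positivity) (by positivity)]
          have hi0 : (0 : ℝ) ≤ i := Nat.cast_nonneg i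
          have hj0 : (0 : ℝ) ≤ j := Nat.cast_nonneg j
          nlinarith [mul_nonneg hi0 hj0, mul_nonneg hi0 (mul_nonneg hi0 hj0)]
        rw [Finset.mul_sum]
        refine (Finset.sum_le_sum h1).trans ?_
        rw [← Finset.mul_sum, Finset.sum_add_distrib]
        have h6 := sum_range_telescope_le m
        have h7 : ∑ i ∈ Finset.range (m + 1), 1 / (2 * ((m : ℝ) + 3)) ≤ 1 / 2 := by
          rw [Finset.sum_const, Finset.card_range, nsmul_eq_mul, mul_one_div,
            div_le_div_iff₀ (by positivity) (by norm_num)]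
          push_cast
          linarith
        linarith
      have hb := hy.bounds (m + 1)
      have hz := hy.zero
      have hm : (0 : ℝ) ≤ m := Nat.cast_nonneg m
      constructor
      -- An increase would give 1/4 - T < (m + 3)(T - T') ≤ 9/128, whereas 1/4 - T ≥ 1/4 - 11/480.
      · by_contra! hlt
        have h8 : 0 ≤ (m + 3) * (y 0 * y (m + 1)) := by
          rw [hz]
          have := hb.1
          positivity
        have h9 : (m + 3) * (T - T') ≤ 9 / 128 := by
          have : T - T' = ∑ i ∈ Finset.range (m + 1), (y i - y (i + 1)) * y (m - i) -
            y 0 * y (m + 1) := by linarith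
          rw [this, mul_sub]
          linarith
        have h10 : ((m : ℝ) + 3) * (m + 4) * y (m + 1) < (m + 3) * (m + 4) * y (m + 1 + 1) :=
          mul_lt_mul_of_pos_left hlt (by positivity)
        have h11 : ((m : ℝ) + 3) * (m + 4) * y (m + 1) = (m + 4) * (1 / 4 - T) := by
          rw [← hrec]
          ring
        have h12 : ((m : ℝ) + 3) * (m + 4) * y (m + 1 + 1) = (m + 3) * (1 / 4 - T') := by
          rw [← hrec']
          ring
        linarith
      -- Subtracting consecutive recursions, (m + 4)(y (m + 1) - y (m + 2)) = y (m + 1) + T' - T ≤ y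
      -- (m + 1) + y (m + 1)², and y ≤ 1/8.
      · nlinarith [hb.1, hy1 (m + 1)]

theorem RiccatiSeq.conv_succ_sub_le_sq (hy : RiccatiSeq y) (m : ℕ) :
    ∑ i ∈ Finset.range (m + 2), y i * y (m + 1 - i) - ∑ i ∈ Finset.range (m + 1), y i * y (m - i) ≤
      1 / (16 * (m + 3) ^ 2) := by
  refine (conv_succ_sub_le fun i _ => (hy.antitone_and_sub_le i).1).trans ?_
  have h := hy.bounds (m + 1)
  push_cast at h
  refine (pow_le_pow_left₀ h.1 h.2 2).trans_eq ?_
  rw [div_pow]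
  ring

end Riccati

/-! ### Hypergeometric coefficients and a Kaluza-type lemma -/

section Haagerup

theorem haagerupCoeff_zero : haagerupCoeff 0 = 1 := by simp [haagerupCoeff, wallisCoeff_zero]

theorem haagerupCoeff_succ (k : ℕ) :
    haagerupCoeff (k + 1) = haagerupCoeff k * ((2 * k + 1) ^ 2 / (4 * (k + 1) * (k + 2))) := by
  simp only [haagerupCoeff, wallisCoeff_succ]
  push_cast
  field_simp
  ring

/-- The left side decreases in k, and the right side is its value at k = 0. -/
theorem haagerupCoeff_mul_le (k : ℕ) :
    haagerupCoeff (k + 4) * ((k + 5) * (2 * k + 9)) ≤ 11025 / 16384 := by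
  induction k with
  | zero => norm_num [haagerupCoeff_succ, haagerupCoeff_zero]
  | succ k ih =>
    refine le_trans ?_ ih
    rw [show k + 1 + 4 = k + 4 + 1 by ring, haagerupCoeff_succ, mul_assoc]
    refine mul_le_mul_of_nonneg_left ?_ (haagerupCoeff_pos _).le
    push_cast
    rw [div_mul_eq_mul_div, div_le_iff₀ (by positivity)]
    have hk : (0 : ℝ) ≤ k := Nat.cast_nonneg k
    have h1 : (0 : ℝ) ≤ k * k := mul_nonneg hk hk
    have h2 : (0 : ℝ) ≤ k * k * k := mul_nonneg h1 hk
    nlinarith [mul_nonneg h1 h1]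

/-- The increment condition that makes the Kaluza-type argument work. -/
theorem RiccatiSeq.increment {y : ℕ → ℝ} (hy : RiccatiSeq y) (m : ℕ) :
    2 / 3 ≤ y (m + 1) / haagerupCoeff (m + 2) - y m / haagerupCoeff (m + 1) := by
  have h0 := hy.zero
  have h1 := hy.succ 0
  have h2 := hy.succ 1
  have h3 := hy.succ 2
  norm_num [Finset.sum_range_succ, h0] at h1 h2 h3
  have e1 : y 1 = 5 / 64 := by linarith
  rw [e1] at h2 h3
  have e2 : y 2 = 59 / 1024 := by linarith
  rw [e2] at h3
  have e3 : y 3 = 47 / 1024 := by linarith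
  rcases lt_or_ge m 3 with h | h
  · interval_cases m <;> norm_num [haagerupCoeff_succ, haagerupCoeff_zero, h0, e1, e2, e3]
  · obtain ⟨k, rfl⟩ := Nat.exists_eq_add_of_le' h
    have hpos := haagerupCoeff_pos (k + 4)
    have hle := haagerupCoeff_mul_le k
    have hr1 := hy.succ (k + 2)
    have hr2 := hy.succ (k + 3)
    have hT := hy.conv_le (k + 3)
    have hD := hy.conv_succ_sub_le_sq (k + 2)
    rw [show k + 2 + 2 = k + 3 + 1 by ring, show k + 2 + 1 = k + 3 by ring] at hD
    rw [show k + 2 + 1 = k + 3 by ring] at hr1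
    push_cast at hr1 hr2 hD
    set T := ∑ i ∈ Finset.range (k + 3), y i * y (k + 2 - i)
    set T' := ∑ i ∈ Finset.range (k + 3 + 1), y i * y (k + 3 - i)
    rw [show k + 3 + 2 = k + 4 + 1 by ring, haagerupCoeff_succ, show k + 3 + 1 = k + 4 by ring]
    rw [show k + 3 + 1 = k + 4 by ring] at hr2
    set a := haagerupCoeff (k + 4)
    have hk : (0 : ℝ) ≤ k := Nat.cast_nonneg k
    have ey1 : y (k + 3) = (1 / 4 - T) / (k + 5) := by
      rw [eq_div_iff (by positivity)]
      linarith
    have ey2 : y (k + 4) = (1 / 4 - T') / (k + 6) := by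
      rw [eq_div_iff (by positivity)]
      linarith
    rw [ey1, ey2]
    push_cast
    -- This is the increment over one denominator, which is at most 11025/16384. The numerator is
    -- bounded below using 1/4 - T' ≥ 109/480 and T' - T ≤ 1/(16 (k + 5)²).
    have e4 : (1 / 4 - T') / (k + 6) / (a * ((2 * (k + 4) + 1) ^ 2 /
        (4 * (k + 4 + 1) * (k + 4 + 2)))) - (1 / 4 - T) / (k + 5) / a =
        ((1 / 4 - T') * ((4 * k + 19) / (2 * k + 9)) - (2 * k + 9) * (T' - T)) /
          (a * ((k + 5) * (2 * k + 9))) := by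
      field_simp
      ring
    rw [e4, le_div_iff₀ (by positivity)]
    have h5 : (109 / 480 : ℝ) * ((4 * k + 19) / (2 * k + 9)) ≤
        (1 / 4 - T') * ((4 * k + 19) / (2 * k + 9)) :=
      mul_le_mul_of_nonneg_right (by linarith) (by positivity)
    have h6 : (2 * k + 9) * (T' - T) ≤ (2 * k + 9) * (1 / (16 * (k + 2 + 3) ^ 2)) :=
      mul_le_mul_of_nonneg_left hD (by positivity)
    have h7 : (2 / 3 * (11025 / 16384) : ℝ) + (2 * k + 9) * (1 / (16 * (k + 2 + 3) ^ 2)) ≤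
        109 / 480 * ((4 * k + 19) / (2 * k + 9)) := by
      rw [mul_one_div, ← sub_nonneg]
      have : (109 / 480 : ℝ) * ((4 * k + 19) / (2 * k + 9)) -
          (2 / 3 * (11025 / 16384) + (2 * k + 9) / (16 * (k + 2 + 3) ^ 2)) =
          (109 / 480 * (4 * k + 19) * (16 * (k + 5) ^ 2) -
            2 / 3 * (11025 / 16384) * (2 * k + 9) * (16 * (k + 5) ^ 2) - (2 * k + 9) ^ 2) /
              ((2 * k + 9) * (16 * (k + 5) ^ 2)) := by
        field_simp
        ring
      rw [this]
      refine div_nonneg ?_ (by positivity)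
      nlinarith [mul_nonneg hk hk, mul_nonneg hk (mul_nonneg hk hk)]
    linarith

/-- A Kaluza-type lemma: the quotient of two power series has nonnegative coefficients if the
denominator is log-convex and the ratio of the coefficients is nondecreasing. -/
theorem nonneg_of_conv_eq {A w e : ℕ → ℝ} (hA : ∀ j, 0 < A j)
    (hlog : ∀ j, A (j + 1) / A j ≤ A (j + 2) / A (j + 1))
    (hconv : ∀ j, ∑ i ∈ Finset.range (j + 1), w i * A (j - i) = e j)
    (he0 : 0 ≤ e 0) (he : ∀ j, e j / A j ≤ e (j + 1) / A (j + 1)) (j : ℕ) : 0 ≤ w j := by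
  have hmono : Monotone fun j => A (j + 1) / A j := monotone_nat_of_le_succ hlog
  induction j using Nat.strong_induction_on with
  | _ j ih =>
    rcases j with _ | j
    · have := hconv 0
      simp at this
      exact nonneg_of_mul_nonneg_left (this ▸ he0) (hA 0)
    · have h1 := hconv (j + 1)
      rw [Finset.sum_range_succ, Nat.sub_self] at h1
      -- Log-convexity and the nonnegativity of the earlier w i bound their share of e (j + 1) by (A
      -- (j + 1) / A j) e j, hence by e (j + 1). What remains, w (j + 1) A 0, is nonnegative.
      have h2 : ∑ i ∈ Finset.range (j + 1), w i * A (j + 1 - i) ≤ A (j + 1) / A j * e j := by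
        rw [← hconv j, Finset.mul_sum]
        refine Finset.sum_le_sum fun i hi => ?_
        have hi' : i ≤ j := Nat.lt_succ_iff.1 (Finset.mem_range.1 hi)
        have h3 := hmono (Nat.sub_le j i)
        simp only at h3
        rw [div_le_iff₀ (hA _)] at h3
        rw [show j + 1 - i = j - i + 1 by omega, mul_left_comm]
        exact mul_le_mul_of_nonneg_left h3 (ih i (Nat.lt_succ_of_le hi'))
      have h4 : A (j + 1) / A j * e j ≤ e (j + 1) := by
        have := he j
        rw [le_div_iff₀ (hA _)] at this
        refine le_trans (le_of_eq ?_) this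
        ring
      exact nonneg_of_mul_nonneg_left (by linarith : 0 ≤ w (j + 1) * A 0) (hA 0)

end Haagerup

end SymmetricGrothendieck

namespace SymmetricGrothendieck

open MeasureTheory Filter Topology
open scoped Real PowerSeries.derivative

/-! ### Evaluating formal power series at real points -/

section Evaluation

/-- The power series `p` converges absolutely at `t`, with sum `v`. -/
def HasPowSum (p : PowerSeries ℝ) (t v : ℝ) : Prop :=
  (Summable fun n => ‖PowerSeries.coeff n p * t ^ n‖) ∧ ∑' n, PowerSeries.coeff n p * t ^ n = v

theorem Tame.hasPowSum {f : ℕ → ℝ} (hf : Tame f) {t : ℝ} (ht : |t| < 1) :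
    HasPowSum (PowerSeries.mk f) t (powSum f t) := by
  refine ⟨?_, ?_⟩ <;> simp only [PowerSeries.coeff_mk]
  · exact hf.summable_norm ht
  · rfl

theorem HasPowSum.add {p q : PowerSeries ℝ} {t v w : ℝ} (hp : HasPowSum p t v)
    (hq : HasPowSum q t w) : HasPowSum (p + q) t (v + w) := by
  have h := hp.1.of_norm.hasSum.add hq.1.of_norm.hasSum
  rw [hp.2, hq.2] at h
  simp only [← add_mul, ← map_add] at h
  refine ⟨?_, h.tsum_eq⟩
  exact h.summable.norm

theorem HasPowSum.mul {p q : PowerSeries ℝ} {t v w : ℝ} (hp : HasPowSum p t v)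
    (hq : HasPowSum q t w) : HasPowSum (p * q) t (v * w) := by
  obtain ⟨hp1, hp2⟩ := hp
  obtain ⟨hq1, hq2⟩ := hq
  have h : ∀ n, PowerSeries.coeff n (p * q) * t ^ n =
      ∑ kl ∈ Finset.HasAntidiagonal.antidiagonal n,
        (fun n => PowerSeries.coeff n p * t ^ n) kl.1 *
          (fun n => PowerSeries.coeff n q * t ^ n) kl.2 := fun n => by
    rw [PowerSeries.coeff_mul, Finset.sum_mul]
    refine Finset.sum_congr rfl fun kl hkl => ?_
    rw [← Finset.HasAntidiagonal.mem_antidiagonal.1 hkl, pow_add]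
    ring
  generalize hf : (fun n => PowerSeries.coeff n p * t ^ n) = f at *
  generalize hg : (fun n => PowerSeries.coeff n q * t ^ n) = g at *
  replace hp1 : Summable fun n => ‖f n‖ := by rw [← hf]; exact hp1
  replace hq1 : Summable fun n => ‖g n‖ := by rw [← hg]; exact hq1
  refine ⟨(summable_norm_sum_mul_antidiagonal_of_summable_norm hp1 hq1).congr fun n => by rw [h], ?_⟩
  rw [tsum_congr h, ← tsum_mul_tsum_eq_tsum_sum_antidiagonal_of_summable_norm hp1 hq1, hp2, hq2]

theorem HasPowSum.unique {p : PowerSeries ℝ} {t v w : ℝ} (hp : HasPowSum p t v)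
    (hq : HasPowSum p t w) : v = w := hp.2.symm.trans hq.2

end Evaluation

/-! ### Formal identities and positivity of the exponent's coefficients -/

section Formal

open PowerSeries

/-- The generating function of `haagerupCoeff`. -/
noncomputable def haagerupSeries : PowerSeries ℝ := mk haagerupCoeff

/-- The generating function of the shifted sequence `haagerupCoeff (k + 1)`. -/
noncomputable def haagerupTail : PowerSeries ℝ := mk fun k => haagerupCoeff (k + 1)

/-- The logarithmic derivative of `haagerupSeries`. -/
noncomputable def haagerupLogDeriv : PowerSeries ℝ := d⁄dX ℝ haagerupSeries * haagerupSeries⁻¹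

theorem haagerupSeries_eq : haagerupSeries = 1 + X * haagerupTail := by
  ext n
  rcases n with _ | n
  · simp [haagerupSeries, haagerupCoeff_zero]
  · rw [map_add, coeff_succ_X_mul]
    simp [haagerupSeries, haagerupTail, coeff_one]

theorem constantCoeff_haagerupSeries : constantCoeff haagerupSeries = 1 := by
  simp [haagerupSeries_eq]

theorem haagerupSeries_ne_zero : haagerupSeries ≠ 0 := fun h => by
  have := constantCoeff_haagerupSeries
  simp [h] at this

theorem haagerupLogDeriv_mul : haagerupLogDeriv * haagerupSeries = d⁄dX ℝ haagerupSeries := by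
  rw [haagerupLogDeriv, mul_assoc, PowerSeries.inv_mul_cancel _ (by
    simp [constantCoeff_haagerupSeries]), mul_one]

theorem derivative_haagerupSeries :
    d⁄dX ℝ haagerupSeries = haagerupTail + X * d⁄dX ℝ haagerupTail := by
  rw [haagerupSeries_eq, map_add, Derivation.leibniz]
  simp
  ring

/-- The hypergeometric differential equation. -/
theorem haagerupSeries_ode :
    (1 - X) * (2 * d⁄dX ℝ haagerupSeries + X * d⁄dX ℝ (d⁄dX ℝ haagerupSeries)) =
      C (1 / 4) * haagerupSeries := by
  have key : ∀ n, coeff n (2 * d⁄dX ℝ haagerupSeries + X * d⁄dX ℝ (d⁄dX ℝ haagerupSeries)) =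
      (n + 1) * (n + 2) * haagerupCoeff (n + 1) := fun n => by
    have h2 : (2 : PowerSeries ℝ) = C 2 := (map_ofNat C 2).symm
    rw [map_add, h2, coeff_C_mul, coeff_derivative]
    rcases n with _ | n
    · simp [haagerupSeries]
    · rw [coeff_succ_X_mul, coeff_derivative, coeff_derivative]
      simp only [haagerupSeries, coeff_mk]
      push_cast
      ring
  ext n
  rw [sub_mul, one_mul, map_sub, key, coeff_C_mul]
  rcases n with _ | n
  · simp [haagerupSeries, haagerupCoeff_succ, haagerupCoeff_zero]
  · rw [coeff_succ_X_mul, key]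
    simp only [haagerupSeries, coeff_mk]
    rw [haagerupCoeff_succ (n + 1)]
    push_cast
    field_simp
    ring

/-- With L = F'/F one has F' = LF and F'' = (L' + L²)F; substituting in the hypergeometric equation
and cancelling F gives the Riccati equation. -/
theorem haagerupLogDeriv_riccati :
    (1 - X) * (2 * haagerupLogDeriv + X * d⁄dX ℝ haagerupLogDeriv + X * haagerupLogDeriv ^ 2) =
      C (1 / 4) := by
  refine mul_right_cancel₀ haagerupSeries_ne_zero ?_
  rw [← haagerupSeries_ode, ← haagerupLogDeriv_mul, Derivation.leibniz, ← haagerupLogDeriv_mul,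
    smul_eq_mul, smul_eq_mul]
  ring

theorem coeff_of_one_sub_X_mul {p : PowerSeries ℝ} {c : ℝ} (h : (1 - X) * p = C c) (n : ℕ) :
    coeff n p = c := by
  induction n with
  | zero =>
    have := congrArg (coeff 0) h
    simpa [sub_mul] using this
  | succ n ih =>
    have := congrArg (coeff (n + 1)) h
    rw [sub_mul, one_mul, map_sub, coeff_succ_X_mul, ih, coeff_C] at this
    simp at this
    linarith

theorem riccatiSeq_haagerupLogDeriv : RiccatiSeq fun n => coeff n haagerupLogDeriv := by
  have h := coeff_of_one_sub_X_mul haagerupLogDeriv_riccati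
  have h2 : (2 : PowerSeries ℝ) = C 2 := (map_ofNat C 2).symm
  constructor
  · have := h 0
    rw [map_add, map_add, h2, coeff_C_mul] at this
    simp at this
    simp only [coeff_zero_eq_constantCoeff]
    linarith
  · intro m
    have := h (m + 1)
    rw [map_add, map_add, h2, coeff_C_mul, coeff_succ_X_mul, coeff_succ_X_mul, coeff_derivative,
      sq, coeff_mul, Finset.Nat.sum_antidiagonal_eq_sum_range_succ_mk] at this
    linarith

/-- The numerator `e` in the quotient defining the exponent. -/
noncomputable def exponentNum : PowerSeries ℝ :=
  3 * haagerupLogDeriv - 3 * haagerupTail - 2 * (X * d⁄dX ℝ haagerupTail)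

theorem coeff_exponentNum (j : ℕ) :
    coeff j exponentNum = 3 * coeff j haagerupLogDeriv - (2 * j + 3) * haagerupCoeff (j + 1) := by
  have h2 : (2 : PowerSeries ℝ) = C 2 := (map_ofNat C 2).symm
  have h3 : (3 : PowerSeries ℝ) = C 3 := (map_ofNat C 3).symm
  rw [exponentNum, map_sub, map_sub, h2, h3, coeff_C_mul, coeff_C_mul, coeff_C_mul]
  rcases j with _ | j
  · simp [haagerupTail]
  · rw [coeff_succ_X_mul, coeff_derivative]
    simp only [haagerupTail, coeff_mk]
    push_cast
    ring

theorem constantCoeff_haagerupTail : constantCoeff haagerupTail = 1 / 8 := by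
  rw [← coeff_zero_eq_constantCoeff_apply]
  simp [haagerupTail, haagerupCoeff_succ, haagerupCoeff_zero]
  norm_num

/-- The power series `t Λ'(t)`, where `Λ` is the exponent. -/
noncomputable def exponentSeries : PowerSeries ℝ := exponentNum * haagerupTail⁻¹

/-- The goal is Λ' = H'/H - 3F'/F. Multiplied by tH, and with tH = F - 1 and F' = H + tH', the right
side becomes 3F'/F - 3H - 2tH', which is `exponentNum`. -/
theorem exponentSeries_mul : exponentSeries * haagerupTail = exponentNum := by
  rw [exponentSeries, mul_assoc, PowerSeries.inv_mul_cancel _ (by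
    rw [constantCoeff_haagerupTail]
    norm_num), mul_one]

theorem conv_exponentSeries (j : ℕ) :
    ∑ i ∈ Finset.range (j + 1), coeff i exponentSeries * haagerupCoeff (j - i + 1) =
      coeff j exponentNum := by
  rw [← exponentSeries_mul, coeff_mul, Finset.Nat.sum_antidiagonal_eq_sum_range_succ_mk]
  simp [haagerupTail]

theorem coeff_zero_exponentNum : coeff 0 exponentNum = 0 := by
  rw [coeff_exponentNum, riccatiSeq_haagerupLogDeriv.zero, haagerupCoeff_succ, haagerupCoeff_zero]
  norm_num

theorem haagerupCoeff_ratio (j : ℕ) : haagerupCoeff (j + 1) / haagerupCoeff j =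
    (2 * j + 1) ^ 2 / (4 * (j + 1) * (j + 2)) := by
  rw [haagerupCoeff_succ, mul_div_cancel_left₀ _ (haagerupCoeff_pos j).ne']

theorem coeff_exponentSeries_nonneg (j : ℕ) : 0 ≤ coeff j exponentSeries := by
  refine nonneg_of_conv_eq (A := fun j => haagerupCoeff (j + 1))
    (e := fun j => coeff j exponentNum) (fun j => haagerupCoeff_pos _) (fun j => ?_)
    conv_exponentSeries coeff_zero_exponentNum.ge (fun j => ?_) j
  · rw [haagerupCoeff_ratio (j + 1), haagerupCoeff_ratio (j + 2),
      div_le_div_iff₀ (by positivity) (by positivity)]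
    push_cast
    have hj : (0 : ℝ) ≤ j := Nat.cast_nonneg j
    nlinarith [mul_nonneg hj hj, mul_nonneg hj (mul_nonneg hj hj)]
  -- With a = `haagerupCoeff`, e_j / a_(j+1) = 3 y_j / a_(j+1) - (2j + 3), so it is nondecreasing
  -- exactly when y_j / a_(j+1) grows by at least 2/3.
  · have h := RiccatiSeq.increment riccatiSeq_haagerupLogDeriv j
    simp only [coeff_exponentNum, sub_div]
    rw [mul_div_cancel_right₀ _ (haagerupCoeff_pos (j + 1)).ne',
      mul_div_cancel_right₀ _ (haagerupCoeff_pos (j + 1 + 1)).ne', mul_div_assoc, mul_div_assoc]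
    push_cast
    linarith

/-- All terms of the convolution are nonnegative, so its last one, w_j / 8, is at most 3 y_j ≤ 3/8.
Boundedness makes Λ converge on |t| < 1. -/
theorem coeff_exponentSeries_le (j : ℕ) : coeff j exponentSeries ≤ 3 := by
  have h := conv_exponentSeries j
  rw [Finset.sum_range_succ, Nat.sub_self, coeff_exponentNum] at h
  have h1 : 0 ≤ ∑ i ∈ Finset.range j, coeff i exponentSeries * haagerupCoeff (j - i + 1) :=
    Finset.sum_nonneg fun i _ => mul_nonneg (coeff_exponentSeries_nonneg i) (haagerupCoeff_pos _).le
  have h2 := (riccatiSeq_haagerupLogDeriv.bounds j).2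
  have h3 : 1 / (4 * ((j : ℝ) + 2)) ≤ 1 / 8 :=
    one_div_le_one_div_of_le (by norm_num) (by linarith [(Nat.cast_nonneg j : (0 : ℝ) ≤ j)])
  have h4 : 0 ≤ (2 * j + 3) * haagerupCoeff (j + 1) :=
    mul_nonneg (by positivity) (haagerupCoeff_pos _).le
  have h5 : haagerupCoeff (0 + 1) = 1 / 8 := by
    rw [haagerupCoeff_succ, haagerupCoeff_zero]
    norm_num
  rw [h5] at h
  linarith

/-- The derivative `Λ'` of the exponent. -/
noncomputable def exponentDeriv : PowerSeries ℝ := mk fun k => coeff (k + 1) exponentSeries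

theorem exponentSeries_eq : exponentSeries = X * exponentDeriv := by
  ext n
  rcases n with _ | n
  · have h := conv_exponentSeries 0
    rw [coeff_zero_exponentNum] at h
    simp at h
    simpa [(haagerupCoeff_pos 1).ne'] using h
  · rw [coeff_succ_X_mul, exponentDeriv, coeff_mk]

/-- This is H'/H = Λ' + 3F'/F with denominators cleared; the term HF' is repeated so that evaluation
needs only sums and products. -/
theorem exponentDeriv_identity :
    d⁄dX ℝ haagerupTail * haagerupSeries = haagerupTail * exponentDeriv * haagerupSeries +
      haagerupTail * d⁄dX ℝ haagerupSeries + haagerupTail * d⁄dX ℝ haagerupSeries +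
      haagerupTail * d⁄dX ℝ haagerupSeries := by
  refine mul_left_cancel₀ (X_ne_zero (R := ℝ)) ?_
  have h1 := exponentSeries_mul
  rw [exponentSeries_eq, exponentNum] at h1
  have h2 := haagerupLogDeriv_mul
  have h3 := derivative_haagerupSeries
  have h4 := haagerupSeries_eq
  linear_combination (-haagerupSeries) * h1 - 3 * h2 -
    3 * haagerupSeries * h3 + 3 * d⁄dX ℝ haagerupSeries * h4

end Formal

/-! ### The representation H = F³ exp(Λ) / 8 -/

section Exponent

theorem haagerupCoeff_le_one (k : ℕ) : haagerupCoeff k ≤ 1 := by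
  have h := wallisCoeff_le_one k
  rw [haagerupCoeff, div_le_one (by positivity)]
  nlinarith [wallisCoeff_pos k, (Nat.cast_nonneg k : (0 : ℝ) ≤ k)]

theorem tame_haagerupCoeff : Tame haagerupCoeff :=
  tame_of_abs_le fun k => by
    rw [abs_of_pos (haagerupCoeff_pos k)]
    exact haagerupCoeff_le_one k

theorem tame_haagerupCoeff_succ : Tame fun k => haagerupCoeff (k + 1) :=
  tame_of_abs_le fun k => by
    rw [abs_of_pos (haagerupCoeff_pos _)]
    exact haagerupCoeff_le_one _

theorem powSum_haagerupCoeff_eq {t : ℝ} (ht : |t| ≤ 1) :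
    powSum haagerupCoeff t = 1 + t * powSum (fun k => haagerupCoeff (k + 1)) t := by
  unfold powSum
  rw [(summable_haagerupCoeff_mul_pow ht).tsum_eq_zero_add, ← tsum_mul_left]
  simp only [pow_zero, mul_one, haagerupCoeff_zero]
  congr 1
  exact tsum_congr fun k => by ring

theorem powSum_haagerupCoeff_succ_one :
    powSum (fun k => haagerupCoeff (k + 1)) 1 = 4 / π - 1 := by
  have h := powSum_haagerupCoeff_eq (t := 1) (by simp)
  rw [powSum_haagerupCoeff_one] at h
  linarith

/-- Here |t H(t)| ≤ H(1) = 4/π - 1 < 1. -/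
theorem powSum_haagerupCoeff_pos {t : ℝ} (ht : |t| ≤ 1) : 0 < powSum haagerupCoeff t := by
  have hs : Summable fun k => haagerupCoeff (k + 1) :=
    (summable_nat_add_iff 1).2 summable_haagerupCoeff
  have h1 : |powSum (fun k => haagerupCoeff (k + 1)) t| ≤ 4 / π - 1 := by
    rw [← powSum_haagerupCoeff_succ_one]
    unfold powSum
    refine tsum_of_norm_bounded (f := fun k => haagerupCoeff (k + 1) * t ^ k)
      (g := fun k => haagerupCoeff (k + 1) * 1 ^ k) ?_ fun k => ?_
    · simpa using hs.hasSum
    · rw [norm_mul, norm_pow, Real.norm_eq_abs, Real.norm_eq_abs, abs_of_pos (haagerupCoeff_pos _)]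
      exact mul_le_mul_of_nonneg_left (pow_le_pow_left₀ (abs_nonneg _) ht k)
        (haagerupCoeff_pos _).le
  have h2 : (4 : ℝ) / π - 1 < 1 := by
    rw [sub_lt_iff_lt_add, div_lt_iff₀ Real.pi_pos]
    linarith [Real.pi_gt_three]
  rw [powSum_haagerupCoeff_eq ht]
  have h3 : |t * powSum (fun k => haagerupCoeff (k + 1)) t| < 1 := by
    rw [abs_mul]
    nlinarith [abs_nonneg t, abs_nonneg (powSum (fun k => haagerupCoeff (k + 1)) t)]
  linarith [(abs_lt.1 h3).1]

/-- The coefficients of the exponent `Λ`. -/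
noncomputable def exponentCoeff (k : ℕ) : ℝ := PowerSeries.coeff k exponentSeries / k

theorem exponentCoeff_nonneg (k : ℕ) : 0 ≤ exponentCoeff k :=
  div_nonneg (coeff_exponentSeries_nonneg k) (Nat.cast_nonneg k)

theorem tame_exponentCoeff : Tame exponentCoeff :=
  tame_of_abs_le (C := 3) fun k => by
    rw [abs_of_nonneg (exponentCoeff_nonneg k)]
    rcases k with _ | k
    · simp [exponentCoeff]
    · refine (div_le_self (coeff_exponentSeries_nonneg _) ?_).trans (coeff_exponentSeries_le _)
      push_cast
      linarith [(Nat.cast_nonneg k : (0 : ℝ) ≤ k)]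

theorem mk_shiftDeriv (f : ℕ → ℝ) :
    PowerSeries.mk (shiftDeriv f) = PowerSeries.derivative ℝ (PowerSeries.mk f) := by
  ext n
  rw [PowerSeries.coeff_derivative, PowerSeries.coeff_mk, PowerSeries.coeff_mk, shiftDeriv, mul_comm]

theorem mk_shiftDeriv_exponentCoeff : PowerSeries.mk (shiftDeriv exponentCoeff) = exponentDeriv := by
  ext n
  rw [exponentDeriv, PowerSeries.coeff_mk, PowerSeries.coeff_mk, shiftDeriv, exponentCoeff]
  push_cast
  field_simp

/-- The exponential representation of the tail of the hypergeometric series. -/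
theorem powSum_haagerupCoeff_succ_eq {t : ℝ} (ht : |t| < 1) :
    powSum (fun k => haagerupCoeff (k + 1)) t =
      1 / 8 * powSum haagerupCoeff t ^ 3 * Real.exp (powSum exponentCoeff t) := by
  -- The function H exp(-Λ) / F³ has zero derivative by the formal identity evaluated at t; its
  -- value at 0 is 1/8.
  have hconst := eq_of_hasDerivAt_zero (g := fun t => powSum (fun k => haagerupCoeff (k + 1)) t *
    Real.exp (-powSum exponentCoeff t) / powSum haagerupCoeff t ^ 3) (fun t ht => by
      have hpos := powSum_haagerupCoeff_pos ht.le
      have dH := tame_haagerupCoeff_succ.hasDerivAt ht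
      have dF := tame_haagerupCoeff.hasDerivAt ht
      have dL := tame_exponentCoeff.hasDerivAt ht
      have vH := tame_haagerupCoeff_succ.hasPowSum ht
      have vF := tame_haagerupCoeff.hasPowSum ht
      have vH' := tame_haagerupCoeff_succ.shiftDeriv.hasPowSum ht
      have vF' := tame_haagerupCoeff.shiftDeriv.hasPowSum ht
      have vL' := tame_exponentCoeff.shiftDeriv.hasPowSum ht
      rw [mk_shiftDeriv] at vH' vF'
      rw [mk_shiftDeriv_exponentCoeff] at vL'
      have hid := exponentDeriv_identity
      have hl := vH'.mul vF
      have hr := ((((vH.mul vL').mul vF).add (vH.mul vF')).add (vH.mul vF')).add (vH.mul vF')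
      change HasPowSum (PowerSeries.derivative ℝ haagerupTail * haagerupSeries) _ _ at hl
      rw [hid] at hl
      have heq := hl.unique hr
      convert! (dH.mul dL.neg.exp).div (dF.pow 3) (pow_ne_zero 3 hpos.ne') using 1
      symm
      rw [div_eq_zero_iff]
      left
      push_cast
      simp only [Pi.neg_apply, Pi.pow_apply, Pi.mul_apply]
      linear_combination Real.exp (-powSum exponentCoeff t) * powSum haagerupCoeff t ^ 2 * heq) ht
  simp only [powSum_zero, haagerupCoeff_succ, haagerupCoeff_zero] at hconst
  -- Division by zero gives 0 here, so Λ has no constant term.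
  have h0 : exponentCoeff 0 = 0 := by simp [exponentCoeff]
  rw [h0, Real.exp_neg, div_eq_iff (pow_ne_zero 3 (powSum_haagerupCoeff_pos ht.le).ne')] at hconst
  have hexp := Real.exp_pos (powSum exponentCoeff t)
  simp only [haagerupCoeff_succ]
  field_simp at hconst ⊢
  norm_num at hconst ⊢
  linarith

end Exponent

end SymmetricGrothendieck

namespace SymmetricGrothendieck

open MeasureTheory Filter Topology ProbabilityTheory
open scoped ComplexConjugate Real

/-! ### Gram matrices and Gaussian kernels as cuts -/

section GramMatrices

variable {n : ℕ}

/-- Gram matrices of finite families of complex vectors. -/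
def IsGram (M : Fin n → Fin n → ℂ) : Prop :=
  ∃ (ι : Type) (_ : Fintype ι) (b : ι → Fin n → ℂ), ∀ i j, M i j = ∑ l, conj (b l i) * b l j

theorem isGram_inner {d : ℕ} (x : Fin n → EuclideanSpace ℂ (Fin d)) :
    IsGram (fun i j => inner ℂ (x i) (x j)) :=
  ⟨Fin d, inferInstance, fun l i => x i l, fun i j => by
    simp [PiLp.inner_apply, mul_comm]⟩

theorem isGram_one : IsGram (fun _ _ => 1 : Fin n → Fin n → ℂ) :=
  ⟨Unit, inferInstance, fun _ _ => 1, fun i j => by simp⟩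

theorem IsGram.conj {M : Fin n → Fin n → ℂ} (hM : IsGram M) :
    IsGram (fun i j => conj (M i j)) := by
  obtain ⟨ι, _, b, hb⟩ := hM
  exact ⟨ι, inferInstance, fun l i => starRingEnd ℂ (b l i), fun i j => by simp [hb]⟩

theorem IsGram.mul {M N : Fin n → Fin n → ℂ} (hM : IsGram M) (hN : IsGram N) :
    IsGram (fun i j => M i j * N i j) := by
  obtain ⟨ι, _, b, hb⟩ := hM
  obtain ⟨κ, _, c, hc⟩ := hN
  refine ⟨ι × κ, inferInstance, fun l i => b l.1 i * c l.2 i, fun i j => ?_⟩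
  beta_reduce
  rw [hb, hc, Finset.sum_mul_sum, Fintype.sum_prod_type]
  refine Finset.sum_congr rfl fun l _ => Finset.sum_congr rfl fun k _ => ?_
  rw [map_mul]
  ring

theorem IsGram.pow {M : Fin n → Fin n → ℂ} (hM : IsGram M) (k : ℕ) :
    IsGram (fun i j => M i j ^ k) := by
  induction k with
  | zero => simpa using isGram_one
  | succ k ih => simpa [pow_succ] using ih.mul hM

theorem IsGram.const_mul {M : Fin n → Fin n → ℂ} (hM : IsGram M) {c : ℝ} (hc : 0 ≤ c) :
    IsGram (fun i j => c * M i j) := by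
  obtain ⟨ι, _, b, hb⟩ := hM
  refine ⟨ι, inferInstance, fun l i => (√c : ℂ) * b l i, fun i j => ?_⟩
  have h : (√c : ℂ) * (√c : ℂ) = c := by exact_mod_cast Real.mul_self_sqrt hc
  beta_reduce
  rw [hb, Finset.mul_sum]
  refine Finset.sum_congr rfl fun l _ => ?_
  rw [map_mul, Complex.conj_ofReal, ← h]
  ring

/-- Gaussian kernels are cuts. -/
theorem isCut_exp_neg_sq (b : Fin n → ℝ) :
    IsCut (fun i j => ((Real.exp (-(b i - b j) ^ 2 / 2) : ℝ) : ℂ)) := by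
  -- The kernel is the characteristic function of a standard Gaussian at b j - b i, an average of
  -- the characters exp(i b s).
  have h := isCut_integral (𝕜 := ℂ) (gaussianReal 0 1)
    (δ := fun i (s : ℝ) => Complex.exp (((b i * s : ℝ) : ℂ) * Complex.I))
    (fun i s => Complex.norm_exp_ofReal_mul_I _)
    (fun i => Continuous.aestronglyMeasurable (by fun_prop))
  convert! h using 3 with i j
  have h1 : ∀ s : ℝ, conj (Complex.exp (((b i * s : ℝ) : ℂ) * Complex.I)) *
      Complex.exp (((b j * s : ℝ) : ℂ) * Complex.I) =
      Complex.exp (((b j - b i : ℝ) : ℂ) * s * Complex.I) := fun s => by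
    rw [conj_exp_ofReal_mul_I, ← Complex.exp_add]
    congr 1
    push_cast
    ring
  simp only [h1]
  rw [← charFun_apply_real, charFun_gaussianReal]
  push_cast
  congr 1
  simp
  ring

theorem isCut_exp_neg_normSq (b : Fin n → ℂ) :
    IsCut (fun i j => ((Real.exp (-‖b i - b j‖ ^ 2 / 2) : ℝ) : ℂ)) := by
  have h := (isCut_exp_neg_sq fun i => (b i).re).mul (isCut_exp_neg_sq fun i => (b i).im)
  convert! h using 3 with i j
  rw [← Complex.ofReal_mul, ← Real.exp_add, ← Complex.normSq_eq_norm_sq, Complex.normSq_apply]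
  congr 2
  simp
  ring

/-- With constant diagonal c, Re M_ij - c is minus half the squared distance between the i-th and
j-th vectors, so the kernel is a product of Gaussian kernels over coordinates. -/
theorem isCut_exp_of_isGram {M : Fin n → Fin n → ℂ} (hM : IsGram M) {c : ℝ}
    (hdiag : ∀ i, M i i = c) : IsCut (fun i j => ((Real.exp ((M i j).re - c) : ℝ) : ℂ)) := by
  obtain ⟨ι, _, b, hb⟩ := hM
  have h := IsCut.prod Finset.univ fun l _ => isCut_exp_neg_normSq (b l)
  convert! h using 3 with i j
  rw [← Complex.ofReal_prod, ← Real.exp_sum]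
  congr 2
  have h1 : ∀ i, c = ∑ l, ‖b l i‖ ^ 2 := fun i => by
    have := hdiag i
    rw [hb] at this
    simp only [Complex.conj_mul'] at this
    exact_mod_cast this.symm
  have h2 : (M i j).re = ∑ l, (conj (b l i) * b l j).re := by
    rw [hb, Complex.re_sum]
  have h3 : ∀ l, -‖b l i - b l j‖ ^ 2 / 2 =
      (conj (b l i) * b l j).re - ‖b l i‖ ^ 2 / 2 - ‖b l j‖ ^ 2 / 2 := fun l => by
    simp only [← Complex.normSq_eq_norm_sq, Complex.normSq_apply]
    simp
    ring
  simp only [h3, Finset.sum_sub_distrib, ← Finset.sum_div, ← h1, h2]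
  ring

end GramMatrices

/-! ### The complex constant 8/π - 1 -/

section ComplexCase

variable {n d : ℕ} {x : Fin n → EuclideanSpace ℂ (Fin d)}

theorem norm_inner_sq_le_one (hx : ∀ i, ‖x i‖ = 1) (i j : Fin n) :
    ‖(inner ℂ (x i) (x j) : ℂ)‖ ^ 2 ≤ 1 :=
  pow_le_one₀ (norm_nonneg _) (by simpa [hx] using norm_inner_le_norm (𝕜 := ℂ) (x i) (x j))

theorem isCut_exp_pow (hx : ∀ i, ‖x i‖ = 1) {c : ℝ} (hc : 0 ≤ c) (k : ℕ) :
    IsCut (fun i j => ((Real.exp (c * (‖(inner ℂ (x i) (x j) : ℂ)‖ ^ 2) ^ k - c) : ℝ) : ℂ)) := by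
  have hg := ((((isGram_inner x).conj).mul (isGram_inner x)).pow k).const_mul hc
  have h := isCut_exp_of_isGram (c := c) hg fun i => by
    simp [hx]
  convert! h using 4 with i j
  rw [Complex.conj_mul', Complex.re_ofReal_mul, ← Complex.ofReal_pow, ← Complex.ofReal_pow,
    Complex.ofReal_re]

/-- The exponential of the series is a limit of finite products of single-power cuts. Taking r < 1
keeps Λ(r) where the series is known to converge. -/
theorem isCut_exp_exponent (hx : ∀ i, ‖x i‖ = 1) {r : ℝ} (hr0 : 0 ≤ r) (hr1 : r < 1) :
    IsCut (fun i j => ((Real.exp (powSum exponentCoeff (r * ‖(inner ℂ (x i) (x j) : ℂ)‖ ^ 2) -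
      powSum exponentCoeff r) : ℝ) : ℂ)) := by
  refine isCut_of_tendsto (l := atTop) (M := fun N i j => ∏ k ∈ Finset.range N,
    ((Real.exp (exponentCoeff k * r ^ k * (‖(inner ℂ (x i) (x j) : ℂ)‖ ^ 2) ^ k -
      exponentCoeff k * r ^ k) : ℝ) : ℂ)) (Eventually.of_forall fun N => ?_) fun i j => ?_
  · exact IsCut.prod _ fun k _ => isCut_exp_pow hx
      (mul_nonneg (exponentCoeff_nonneg k) (pow_nonneg hr0 k)) k
  · have ht0 : 0 ≤ ‖(inner ℂ (x i) (x j) : ℂ)‖ ^ 2 := by positivity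
    have ht1 := norm_inner_sq_le_one hx i j
    set t := ‖(inner ℂ (x i) (x j) : ℂ)‖ ^ 2
    have h1 : |r * t| < 1 := by
      rw [abs_of_nonneg (by positivity)]
      nlinarith
    have h2 : |r| < 1 := by rwa [abs_of_nonneg hr0]
    have h3 := (tame_exponentCoeff.summable h1).hasSum.sub (tame_exponentCoeff.summable h2).hasSum
    have h4 := (Complex.continuous_ofReal.tendsto _).comp
      ((Real.continuous_exp.tendsto _).comp h3.tendsto_sum_nat)
    refine h4.congr fun N => ?_
    simp only [Function.comp]
    rw [← Complex.ofReal_prod, ← Real.exp_sum]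
    congr 2
    exact Finset.sum_congr rfl fun k _ => by rw [mul_pow]; ring

theorem continuousOn_powSum {f : ℕ → ℝ} (h0 : ∀ k, 0 ≤ f k) (hf : Summable f) :
    ContinuousOn (powSum f) (Set.Icc 0 1) := by
  refine continuousOn_tsum (fun k => by fun_prop) hf fun k t ht => ?_
  rw [norm_mul, norm_pow, Real.norm_of_nonneg (h0 k), Real.norm_of_nonneg ht.1]
  exact mul_le_of_le_one_right (h0 k) (pow_le_one₀ ht.1 ht.2)

/-- The quotient `H / F ^ 3`, which equals `exp Λ / 8` on `[0, 1)`. -/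
noncomputable def tailRatio (t : ℝ) : ℝ :=
  powSum (fun k => haagerupCoeff (k + 1)) t / powSum haagerupCoeff t ^ 3

theorem continuousOn_tailRatio : ContinuousOn tailRatio (Set.Icc 0 1) :=
  (continuousOn_powSum (fun k => (haagerupCoeff_pos _).le)
    ((summable_nat_add_iff 1).2 summable_haagerupCoeff)).div
    ((continuousOn_powSum (fun k => (haagerupCoeff_pos k).le) summable_haagerupCoeff).pow 3)
    fun t ht => (pow_pos (powSum_haagerupCoeff_pos (by rw [abs_of_nonneg ht.1]; exact ht.2)) 3).ne'

theorem tailRatio_eq {t : ℝ} (h0 : 0 ≤ t) (h1 : t < 1) :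
    tailRatio t = 1 / 8 * Real.exp (powSum exponentCoeff t) := by
  have ht : |t| < 1 := by rwa [abs_of_nonneg h0]
  have := powSum_haagerupCoeff_pos ht.le
  rw [tailRatio, powSum_haagerupCoeff_succ_eq ht]
  field_simp

theorem tendsto_tailRatio {t : ℝ} (h0 : 0 ≤ t) (h1 : t ≤ 1) :
    Tendsto (fun r => tailRatio (r * t)) (𝓝[<] 1) (𝓝 (tailRatio t)) := by
  refine (continuousOn_tailRatio t ⟨h0, h1⟩).tendsto.comp (tendsto_nhdsWithin_iff.2 ⟨?_, ?_⟩)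
  · have : Tendsto (fun r : ℝ => r * t) (𝓝 1) (𝓝 (1 * t)) := by
      apply Continuous.tendsto
      fun_prop
    rw [one_mul] at this
    exact this.mono_left nhdsWithin_le_nhds
  · filter_upwards [Ioo_mem_nhdsLT (zero_lt_one' ℝ)] with r hr
    exact ⟨mul_nonneg hr.1.le h0, by nlinarith [hr.1, hr.2]⟩

theorem pairing_const_mul (c : ℂ) (A M : Fin n → Fin n → ℂ) :
    pairing A (fun i j => c * M i j) = c * pairing A M := by
  simp only [pairing, Finset.mul_sum]
  exact Finset.sum_congr rfl fun i _ => Finset.sum_congr rfl fun j _ => by ring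

theorem pairing_sub (A M N : Fin n → Fin n → ℂ) :
    pairing A (fun i j => M i j - N i j) = pairing A M - pairing A N := by
  simp [pairing, mul_sub, Finset.sum_sub_distrib]

/-- The tail `z |z|² H(|z|²)` of Haagerup's function, applied to a Gram matrix, is a multiple of a
cut. -/
theorem norm_pairing_tail_le (hx : ∀ i, ‖x i‖ = 1) (A : Fin n → Fin n → ℂ) :
    ‖pairing A (fun i j => inner ℂ (x i) (x j) * ((‖(inner ℂ (x i) (x j) : ℂ)‖ ^ 2 *
      powSum (fun k => haagerupCoeff (k + 1)) (‖(inner ℂ (x i) (x j) : ℂ)‖ ^ 2) : ℝ) : ℂ))‖ ≤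
      (4 / π - 1) * theta A := by
  have hpi := Real.pi_pos
  set M : Fin n → Fin n → ℂ := fun i j => (π / 4 : ℂ) * inner ℂ (x i) (x j) *
      powSum haagerupCoeff (‖(inner ℂ (x i) (x j) : ℂ)‖ ^ 2) with hM
  -- The product M · (M · conj M) equals (π/4)³ z |z|² F(|z|²)³, the prefactor of the tail.
  set N : ℝ → Fin n → Fin n → ℂ := fun r i j => M i j * (M i j * conj (M i j)) *
    ((Real.exp (powSum exponentCoeff (r * ‖(inner ℂ (x i) (x j) : ℂ)‖ ^ 2) -
      powSum exponentCoeff r) : ℝ) : ℂ) with hN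
  have hcut : ∀ᶠ r in 𝓝[<] (1 : ℝ), IsCut (N r) := by
    filter_upwards [Ioo_mem_nhdsLT (zero_lt_one' ℝ)] with r hr
    have h := isCut_phase hx
    exact (h.mul (h.mul h.conj)).mul (isCut_exp_exponent hx hr.1.le hr.2)
  have hlim := tendsto_tailRatio zero_le_one le_rfl
  simp only [mul_one] at hlim
  -- Since F(1)³ = (4/π)³, the limiting multiple of the cut is exactly H(1).
  have h1 : (4 / π) ^ 3 * tailRatio 1 = 4 / π - 1 := by
    rw [tailRatio, powSum_haagerupCoeff_one, powSum_haagerupCoeff_succ_one]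
    field_simp
  have hbound : Tendsto (fun r => (4 / π) ^ 3 * tailRatio r * theta A) (𝓝[<] 1)
      (𝓝 ((4 / π - 1) * theta A)) := by
    rw [← h1]
    exact (hlim.const_mul _).mul_const _
  refine le_of_tendsto_of_tendsto (tendsto_pairing A (l := 𝓝[<] (1 : ℝ))
    (M := fun r i j => (((4 / π) ^ 3 * tailRatio r : ℝ) : ℂ) * N r i j) fun i j => ?_).norm hbound ?_
  · have ht0 : 0 ≤ ‖(inner ℂ (x i) (x j) : ℂ)‖ ^ 2 := by positivity
    have ht1 := norm_inner_sq_le_one hx i j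
    have hFpos := powSum_haagerupCoeff_pos
      (t := ‖(inner ℂ (x i) (x j) : ℂ)‖ ^ 2) (by rwa [abs_of_nonneg ht0])
    have hlim' := tendsto_tailRatio ht0 ht1
    have hmulconj := Complex.mul_conj' (inner ℂ (x i) (x j))
    simp only [hN, hM]
    set z : ℂ := inner ℂ (x i) (x j)
    have h2 : z * ((‖z‖ ^ 2 * powSum (fun k => haagerupCoeff (k + 1)) (‖z‖ ^ 2) : ℝ) : ℂ) =
        z * ((‖z‖ ^ 2 * powSum haagerupCoeff (‖z‖ ^ 2) ^ 3 * tailRatio (‖z‖ ^ 2) : ℝ) : ℂ) := by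
      rw [tailRatio, mul_assoc (‖z‖ ^ 2), mul_div_cancel₀ _ (pow_pos hFpos 3).ne']
    rw [h2]
    have h3 := ((Complex.continuous_ofReal.tendsto _).comp
      (hlim'.const_mul (‖z‖ ^ 2 * powSum haagerupCoeff (‖z‖ ^ 2) ^ 3))).const_mul z
    refine h3.congr' ?_
    filter_upwards [Ioo_mem_nhdsLT (zero_lt_one' ℝ)] with r hr
    simp only [Function.comp]
    have hpi' : (π : ℂ) ≠ 0 := by simp [Real.pi_ne_zero]
    rw [tailRatio_eq hr.1.le hr.2, tailRatio_eq (mul_nonneg hr.1.le ht0)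
      (by nlinarith [hr.1, hr.2]), Real.exp_sub]
    have hexp := (Real.exp_pos (powSum exponentCoeff r)).ne'
    have hconj4 : conj (π / 4 : ℂ) = π / 4 := by
      have := Complex.conj_ofReal (π / 4)
      push_cast at this
      exact this
    rw [map_mul, map_mul, Complex.conj_ofReal, hconj4]
    push_cast
    field_simp
    linear_combination (-(z * (powSum haagerupCoeff (‖z‖ ^ 2) : ℂ) ^ 3)) * hmulconj
  · filter_upwards [hcut, Ioo_mem_nhdsLT (zero_lt_one' ℝ)] with r hr hr'
    rw [pairing_const_mul, norm_mul, Complex.norm_real, Real.norm_of_nonneg]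
    · refine mul_le_mul_of_nonneg_left (hr A) ?_
      rw [tailRatio_eq hr'.1.le hr'.2]
      positivity
    · rw [tailRatio_eq hr'.1.le hr'.2]
      positivity

theorem eight_div_pi_sub_one_mem_gammaConstants : 8 / π - 1 ∈ gammaConstants ℂ := by
  have hpi := Real.pi_pos
  have hpi' : (π : ℂ) ≠ 0 := by simp [Real.pi_ne_zero]
  refine mem_gammaConstants_of_forall ?_ fun n d A x hx => ?_
  · rw [sub_pos, lt_div_iff₀ hpi]
    linarith [Real.pi_lt_four]
  · have h1 := isCut_phase hx A
    have h2 := norm_pairing_tail_le hx A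
    set M : Fin n → Fin n → ℂ := fun i j => (π / 4 : ℂ) * inner ℂ (x i) (x j) *
      powSum haagerupCoeff (‖(inner ℂ (x i) (x j) : ℂ)‖ ^ 2) with hM
    set N : Fin n → Fin n → ℂ := fun i j =>
      inner ℂ (x i) (x j) * ((‖(inner ℂ (x i) (x j) : ℂ)‖ ^ 2 *
        powSum (fun k => haagerupCoeff (k + 1)) (‖(inner ℂ (x i) (x j) : ℂ)‖ ^ 2) : ℝ) : ℂ) with hN
    -- This is z = z F(|z|²) - z |z|² H(|z|²). The two terms cost 4/π and 4/π - 1.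
    have h3 : (fun i j => inner ℂ (x i) (x j)) =
        fun i j => ((4 / π : ℝ) : ℂ) * M i j - N i j := by
      funext i j
      have ht : |‖(inner ℂ (x i) (x j) : ℂ)‖ ^ 2| ≤ 1 := by
        rw [abs_of_nonneg (by positivity)]
        exact norm_inner_sq_le_one hx i j
      simp only [hM, hN]
      rw [powSum_haagerupCoeff_eq ht]
      push_cast
      field_simp
      ring
    rw [h3, pairing_sub, pairing_const_mul]
    refine (norm_sub_le _ _).trans ?_
    rw [norm_mul, Complex.norm_real, Real.norm_of_nonneg (by positivity)]
    have h4 : 4 / π * ‖pairing A M‖ ≤ 4 / π * theta A :=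
      mul_le_mul_of_nonneg_left h1 (by positivity)
    have h5 : (8 : ℝ) / π = 4 / π + 4 / π := by ring
    rw [h5]
    linarith

end ComplexCase

end SymmetricGrothendieck

theorem theorem4p4 :
    (∃ Kγ KΓ : ℝ,
      IsLeast (SymmetricGrothendieck.gammaConstants ℝ) Kγ ∧
      IsLeast (SymmetricGrothendieck.GammaConstants ℝ) KΓ ∧
      KΓ ≤ Kγ ∧ Kγ ≤ Real.sinh (Real.pi / 2)) ∧
    (∃ Kγ KΓ : ℝ,
      IsLeast (SymmetricGrothendieck.gammaConstants ℂ) Kγ ∧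
      IsLeast (SymmetricGrothendieck.GammaConstants ℂ) KΓ ∧
      KΓ ≤ Kγ ∧ Kγ ≤ 8 / Real.pi - 1) :=
  ⟨SymmetricGrothendieck.exists_isLeast_constants
      SymmetricGrothendieck.sinh_pi_div_two_mem_gammaConstants,
    SymmetricGrothendieck.exists_isLeast_constants
      SymmetricGrothendieck.eight_div_pi_sub_one_mem_gammaConstants⟩
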